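/- **Setting.** Let $d\ge 1$, $|v|=\sum_i v_i$ for $v\in\mathbb R^d_+$, $\mathbb S^{d-1}_+=\{v\in\mathbb R^d_+:|v|=1\}$, and for a nonnegative $d\times d$ matrix $g$ let $\|g\|=\sup_{x\in\mathbb S^{d-1}_+}|gx|$ and $\iota(g)=\inf_{x\in\mathbb S^{d-1}_+}|gx|$. Let $(M_n,Q_n)_{n\ge1}$ be i.i.d. pairs of a nonnegative $d\times d$ random matrix and a nonnegative random vector in $\mathbb R^d$; let $\mu$ be the law of $M_1$, and put $$V_n=Q_1+M_1Q_2+\cdots+(M_1\cdots M_{n-1})Q_n,\qquad V_n^*=M_nV_{n-1}^*+Q_n,\quad V_0=V_0^*=0 .$$ Let $I_\mu=\{s\ge0:\mathbb E\|M_1\|^s<\infty\}$ and, for $s\in I_\mu$, $\kappa(s)=\lim_{n\to\infty}(\mathbb E\|M_1\cdots M_n\|^s)^{1/n}$. **Assumptions.** (i) $\alpha$ is an interior point of $I_\mu$ with $\kappa(\alpha)=1$, there is $\eta>0$ with $\mathbb E\big[\|M_1\|^{\alpha+\eta}\iota(M_1)^{-\eta}\big]<\infty$ and $\mathbb E|Q_1|^{\alpha+\eta}<\infty$,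 and $\mathbb P(Q_1=0)<1$. Moreover $\kappa$ is not identically $1$ on $(0,\alpha)$. (ii) Almost surely every row and every column of $M_1$ has a strictly positive entry, and the closed semigroup generated by the support of $\mu$ contains a matrix with all entries strictly positive. For $s\in I_\mu$ let $P_s^*\varphi(x)=\int |g^{\mathrm T}x|^s\varphi\big(g^{\mathrm T}x/|g^{\mathrm T}x|\big)\,\mu(dg)$ for bounded measurable $\varphi$ on $\mathbb S^{d-1}_+$. For a probability measure $\nu_s^*$ on $\mathbb S^{d-1}_+$ with $\nu_s^*P_s^*=\kappa(s)\nu_s^*$ put $r_s(x)=\int\langle x,y\rangle^s\,\nu_s^*(dy)$. **Lemma.** Let $s>\alpha$, $s\in I_\mu$ and $\mathbb E|Q_1|^s<\infty$. Then such a $\nu_s^*$ exists, and for every such $\nu_s^*$ the limit $$\lim_{n\to\infty}\frac1{\kappa(s)^n}\,\mathbb E\Big[|V_n|^s\,r_s\Big(\frac{V_n}{|V_n|}\Big)\Big]$$ exists and lies in $(0,\infty)$ (the integrand being $0$ where $V_n=0$), all these expectations being finite; the same limit is obtained with $V_n^*$ in place of $V_n$. Moreover $\kappa(s)^{-n}|V_n^*|^s\,r_s(V_n^*/|V_n^*|)$,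 $n\ge0$, is an $L^1$-bounded submartingale with respect to the filtration $\sigma((M_i,Q_i):1\le i\le n)$. In particular $\mathbb E|V_n|^s$ and $\mathbb E|V_n^*|^s$ are finite and there are constants $0<c\le C<\infty$ such that $c\le\mathbb E|V_n|^s/\kappa(s)^n\le C$ and $c\le\mathbb E|V_n^*|^s/\kappa(s)^n\le C$ for all $n\ge1$. -/

import Mathlib

open MeasureTheory ProbabilityTheory Filter Topology
open scoped Matrix NNReal ENNReal

namespace Perpetuity

/-- The Borel (product) sigma-algebra on real `d × d` matrices. -/
instance matrixMeasurableSpace {d : ℕ} : MeasurableSpace (Matrix (Fin d) (Fin d) ℝ) :=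
  inferInstanceAs (MeasurableSpace (Fin d → Fin d → ℝ))

instance matrixBorelSpace {d : ℕ} : BorelSpace (Matrix (Fin d) (Fin d) ℝ) :=
  inferInstanceAs (BorelSpace (Fin d → Fin d → ℝ))

noncomputable section

/-- The norm `|v| = ∑ i, |v i|`, which is the sum of the coordinates on the nonnegative orthant. -/
def vnorm {d : ℕ} (v : Fin d → ℝ) : ℝ := ∑ i, |v i|

/-- `v / |v|`, with value `0` at `v = 0`. -/
def direction {d : ℕ} (v : Fin d → ℝ) : Fin d → ℝ := (vnorm v)⁻¹ • v

/-- The operator norm `‖g‖ = sup |g x|` over the simplex of nonnegative vectors `x` with `|x| = 1`. -/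
def opNorm {d : ℕ} (g : Matrix (Fin d) (Fin d) ℝ) : ℝ :=
  ⨆ x : stdSimplex ℝ (Fin d), vnorm (g *ᵥ (x : Fin d → ℝ))

/-- `ι(g) = inf |g x|` over the simplex of nonnegative vectors `x` with `|x| = 1`. -/
def iota {d : ℕ} (g : Matrix (Fin d) (Fin d) ℝ) : ℝ :=
  ⨅ x : stdSimplex ℝ (Fin d), vnorm (g *ᵥ (x : Fin d → ℝ))

/-- Every row and every column has a strictly positive entry. -/
def Allowable {d : ℕ} (g : Matrix (Fin d) (Fin d) ℝ) : Prop :=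
  (∀ i, ∃ j, 0 < g i j) ∧ (∀ j, ∃ i, 0 < g i j)

/-- The smallest closed semigroup of matrices that contains the support of `μ`. -/
def Gam {d : ℕ} (μ : Measure (Matrix (Fin d) (Fin d) ℝ)) :
    Subsemigroup (Matrix (Fin d) (Fin d) ℝ) :=
  (Subsemigroup.closure μ.support).topologicalClosure

/-- Almost every matrix is allowable, and the closed semigroup generated by the support of `μ`
contains a strictly positive matrix. -/
structure AllowabilityPositivity {d : ℕ} (μ : Measure (Matrix (Fin d) (Fin d) ℝ)) : Prop where
  allowable : ∀ᵐ g ∂μ, Allowable g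
  positive : ∃ g ∈ Gam μ, ∀ i j, 0 < g i j

/-- `I_μ = {s ≥ 0 : ∫ ‖g‖ ^ s μ(dg) < ∞}`. -/
def momentSet {d : ℕ} (μ : Measure (Matrix (Fin d) (Fin d) ℝ)) : Set ℝ :=
  {s | 0 ≤ s ∧ Integrable (fun g => opNorm g ^ s) μ}

/-- The conjugate transfer operator `(P_s^* φ)(x) = ∫ |gᵀ x| ^ s φ(gᵀ x / |gᵀ x|) μ(dg)`. -/
def conjTransfer {d : ℕ} (μ : Measure (Matrix (Fin d) (Fin d) ℝ)) (s : ℝ)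
    (φ : (Fin d → ℝ) → ℝ) (x : Fin d → ℝ) : ℝ :=
  ∫ g, vnorm (gᵀ *ᵥ x) ^ s * φ (direction (gᵀ *ᵥ x)) ∂μ

/-- `ν` is a probability measure carried by the simplex with `ν P_s^* = k ν`, tested against all
bounded measurable functions. -/
structure IsConjEigenmeasure {d : ℕ} (μ : Measure (Matrix (Fin d) (Fin d) ℝ)) (s k : ℝ)
    (ν : Measure (Fin d → ℝ)) : Prop where
  prob : IsProbabilityMeasure ν
  carried : ν (stdSimplex ℝ (Fin d))ᶜ = 0
  eigen : ∀ φ : (Fin d → ℝ) → ℝ, Measurable φ → (∃ C : ℝ, ∀ x, |φ x| ≤ C) →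
    ∫ x, conjTransfer μ s φ x ∂ν = k * ∫ x, φ x ∂ν

/-- `r_s(x) = ∫ ⟨x, y⟩ ^ s ν(dy)`, where `ν` is to be the eigenmeasure of `P_s^*`. -/
def eigenfun {d : ℕ} (s : ℝ) (ν : Measure (Fin d → ℝ)) (x : Fin d → ℝ) : ℝ :=
  ∫ y, (x ⬝ᵥ y) ^ s ∂ν

/- The sequence is indexed from `0`: `M n` and `Q n` stand for the pair with number `n + 1`. -/

/-- `Π_n`, the product of the first `n` matrices, newest factor on the right. -/
def prodMat {Ω : Type*} {d : ℕ} (M : ℕ → Ω → Matrix (Fin d) (Fin d) ℝ) :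
    ℕ → Ω → Matrix (Fin d) (Fin d) ℝ
  | 0, _ => 1
  | n + 1, ω => prodMat M n ω * M n ω

/-- The perpetuity sequence `V_n = Q_1 + M_1 Q_2 + ⋯ + (M_1 ⋯ M_{n-1}) Q_n`. -/
def perp {Ω : Type*} {d : ℕ} (M : ℕ → Ω → Matrix (Fin d) (Fin d) ℝ) (Q : ℕ → Ω → Fin d → ℝ)
    (n : ℕ) (ω : Ω) : Fin d → ℝ :=
  ∑ k ∈ Finset.range n, prodMat M k ω *ᵥ Q k ω

/-- The forward process `V_n^* = M_n V_{n-1}^* + Q_n`, with `V_0^* = 0`. -/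
def forward {Ω : Type*} {d : ℕ} (M : ℕ → Ω → Matrix (Fin d) (Fin d) ℝ)
    (Q : ℕ → Ω → Fin d → ℝ) : ℕ → Ω → Fin d → ℝ
  | 0, _ => 0
  | n + 1, ω => M n ω *ᵥ forward M Q n ω + Q n ω

/-- `κ(s) = lim_n (E ‖Π_n‖ ^ s) ^ (1 / n)`; the limit exists for `s ∈ I_μ` by submultiplicativity. -/
def kappa {Ω : Type*} [MeasurableSpace Ω] {d : ℕ} (P : Measure Ω)
    (M : ℕ → Ω → Matrix (Fin d) (Fin d) ℝ) (s : ℝ) : ℝ :=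
  limUnder atTop fun n : ℕ => (∫ ω, opNorm (prodMat M n ω) ^ s ∂P) ^ (1 / (n : ℝ))

/-- The moment condition that introduces `α`: `α` is interior to `I_μ`, `κ(α) = 1`
(that is, `Λ(α) = log κ(α) = 0`), and `E ‖M_1‖ ^ (α + η) ι(M_1) ^ (-η) < ∞` and
`E |Q_1| ^ (α + η) < ∞` for some `η > 0`; moreover `P (Q_1 = 0) < 1`. -/
structure MomentCondition {Ω : Type*} [MeasurableSpace Ω] {d : ℕ} (P : Measure Ω)
    (M : ℕ → Ω → Matrix (Fin d) (Fin d) ℝ) (Q : ℕ → Ω → Fin d → ℝ) (α : ℝ) : Prop where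
  mem_interior : α ∈ interior (momentSet (P.map (M 0)))
  kappa_eq_one : kappa P M α = 1
  moments : ∃ η : ℝ, 0 < η ∧
    ∫⁻ ω, ENNReal.ofReal (opNorm (M 0 ω)) ^ (α + η) * ENNReal.ofReal (iota (M 0 ω)) ^ (-η) ∂P < ∞ ∧
    Integrable (fun ω => vnorm (Q 0 ω) ^ (α + η)) P
  nonzero : P {ω | Q 0 ω = 0} < 1

/-- The filtration `F_n` generated by the first `n` pairs `(M_i, Q_i)`. -/
def history {Ω : Type*} [mΩ : MeasurableSpace Ω] {d : ℕ}
    (M : ℕ → Ω → Matrix (Fin d) (Fin d) ℝ) (Q : ℕ → Ω → Fin d → ℝ)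
    (hM : ∀ i, Measurable (M i)) (hQ : ∀ i, Measurable (Q i)) : Filtration ℕ mΩ where
  seq n := ⨆ i : ℕ, ⨆ _ : i < n, MeasurableSpace.comap (fun ω => (M i ω, Q i ω)) inferInstance
  mono' := fun _ _ hmn => iSup_mono fun _ => iSup_le fun hi =>
    le_iSup_of_le (lt_of_lt_of_le hi hmn) le_rfl
  le' := fun _ => iSup_le fun i => iSup_le fun _ => ((hM i).prodMk (hQ i)).comap_le

/-- `κ ^ (-n) |v| ^ s r_s(v / |v|)`, which is `0` for `v = 0` and `s > 0`. -/
def weight {d : ℕ} (s k : ℝ) (ν : Measure (Fin d → ℝ)) (n : ℕ) (v : Fin d → ℝ) : ℝ :=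
  (1 / k ^ n) * (vnorm v ^ s * eigenfun s ν (direction v))

end

end Perpetuity

open Perpetuity

namespace Perpetuity

section

variable {d : ℕ}

/-! Write `R(v) = ∫ ⟨v, y⟩^s ν(dy)` for the `s`-homogeneous extension of `r_s` to the orthant
(`homEigenfun`). Duality turns the eigenmeasure equation into `E R(M v) = k R(v)` with `k = κ(s)`
(`lintegral_homEigenfun_mulVec`), and `R` is monotone in each coordinate. Since `V*_{n+1} ≥ M_{n+1}
V*_n` coordinatewise, with `M_{n+1}` independent of the past, `k^{-n} R(V*_n)` is a submartingale
and its means increase.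

The means are bounded because `k > 1`. Indeed `log κ` is convex and vanishes at `0` and `α`; as `κ`
is not identically `1` between them, it is less than `1` at some point there and hence greater than
`1` beyond `α` (`one_lt_growth_rate`). With `p = max s 1`, Minkowski's inequality (subadditivity of
`x^s` if `s ≤ 1`) gives `S_{n+1} ≤ k^{1/p} S_n + const` for `S_n = (E R(V*_n))^{1/p}`, and a
geometric sum with ratio `k^{1/p} > 1` is of the order of its last term
(`exists_lintegral_homEigenfun_forward_le`).

The limit is positive because `R(v) ≥ c |v|^s` (`exists_le_homEigenfun`): the vectors of the orthant
where `R` vanishes form a cone stable under the closed semigroup of `μ`, which contains a positive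
matrix. The same bound, with `R(v) ≤ |v|^s`, transfers everything to `E|V*_n|^s`, and `V_n`, `V*_n`
have the same law for each fixed `n`.

The eigenmeasure comes from a Krylov–Bogoliubov argument (`exists_isConjEigenmeasure`): a cluster
point of averages of the measures obtained by iterating `k^{-1} P_s^*` from the barycentre of the
simplex. -/

instance matrixSecondCountable : SecondCountableTopology (Matrix (Fin d) (Fin d) ℝ) :=
  inferInstanceAs (SecondCountableTopology (Fin d → Fin d → ℝ))

/-! ### The norms -/

lemma vnorm_nonneg (v : Fin d → ℝ) : 0 ≤ vnorm v := Finset.sum_nonneg fun _ _ => abs_nonneg _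

lemma vnorm_of_nonneg {v : Fin d → ℝ} (hv : ∀ i, 0 ≤ v i) : vnorm v = ∑ i, v i :=
  Finset.sum_congr rfl fun i _ => abs_of_nonneg (hv i)

lemma continuous_vnorm : Continuous (vnorm : (Fin d → ℝ) → ℝ) := by
  unfold vnorm; fun_prop

lemma measurable_vnorm : Measurable (vnorm : (Fin d → ℝ) → ℝ) := continuous_vnorm.measurable

lemma vnorm_zero : vnorm (0 : Fin d → ℝ) = 0 := by simp [vnorm]

lemma vnorm_eq_zero {v : Fin d → ℝ} : vnorm v = 0 ↔ v = 0 := by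
  unfold vnorm
  rw [Finset.sum_eq_zero_iff_of_nonneg fun _ _ => abs_nonneg _]
  simp [funext_iff]

lemma vnorm_pos {v : Fin d → ℝ} (hv : v ≠ 0) : 0 < vnorm v :=
  (vnorm_nonneg v).lt_of_ne fun h => hv (vnorm_eq_zero.1 h.symm)

lemma abs_le_vnorm (v : Fin d → ℝ) (i : Fin d) : |v i| ≤ vnorm v :=
  Finset.single_le_sum (f := fun i => |v i|) (fun _ _ => abs_nonneg _) (Finset.mem_univ i)

lemma vnorm_smul (c : ℝ) (v : Fin d → ℝ) : vnorm (c • v) = |c| * vnorm v := by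
  simp [vnorm, abs_mul, Finset.mul_sum]

lemma vnorm_of_mem_stdSimplex {x : Fin d → ℝ} (hx : x ∈ stdSimplex ℝ (Fin d)) : vnorm x = 1 := by
  rw [vnorm_of_nonneg hx.1, hx.2]

lemma vnorm_coe_stdSimplex (x : stdSimplex ℝ (Fin d)) : vnorm (x : Fin d → ℝ) = 1 :=
  vnorm_of_mem_stdSimplex x.2

lemma vnorm_smul_direction (v : Fin d → ℝ) : vnorm v • direction v = v := by
  by_cases hv : v = 0
  · simp [hv, direction]
  · rw [direction, smul_smul, mul_inv_cancel₀ (vnorm_pos hv).ne', one_smul]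

lemma direction_nonneg {v : Fin d → ℝ} (hv : ∀ i, 0 ≤ v i) (i : Fin d) : 0 ≤ direction v i :=
  mul_nonneg (inv_nonneg.2 (vnorm_nonneg v)) (hv i)

lemma direction_mem_stdSimplex {v : Fin d → ℝ} (hv : ∀ i, 0 ≤ v i) (h0 : v ≠ 0) :
    direction v ∈ stdSimplex ℝ (Fin d) := by
  refine ⟨direction_nonneg hv, ?_⟩
  rw [← vnorm_of_nonneg (direction_nonneg hv), direction, vnorm_smul,
    abs_of_pos (inv_pos.2 (vnorm_pos h0)), inv_mul_cancel₀ (vnorm_pos h0).ne']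

lemma direction_smul {c : ℝ} (hc : 0 < c) (v : Fin d → ℝ) : direction (c • v) = direction v := by
  rw [direction, vnorm_smul, abs_of_pos hc, smul_smul, direction]
  congr 1
  field_simp

lemma measurable_direction : Measurable (direction : (Fin d → ℝ) → Fin d → ℝ) :=
  measurable_vnorm.inv.smul measurable_id

lemma continuousAt_direction {v : Fin d → ℝ} (hv : v ≠ 0) :
    ContinuousAt (direction : (Fin d → ℝ) → Fin d → ℝ) v :=
  (continuous_vnorm.continuousAt.inv₀ (vnorm_pos hv).ne').smul continuousAt_id

/-- The `j`-th column sum of absolute values. -/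
noncomputable def colSum (g : Matrix (Fin d) (Fin d) ℝ) (j : Fin d) : ℝ := ∑ i, |g i j|

lemma colSum_nonneg (g : Matrix (Fin d) (Fin d) ℝ) (j : Fin d) : 0 ≤ colSum g j :=
  Finset.sum_nonneg fun _ _ => abs_nonneg _

lemma vnorm_mulVec_le_sum (g : Matrix (Fin d) (Fin d) ℝ) (x : Fin d → ℝ) :
    vnorm (g *ᵥ x) ≤ ∑ j, colSum g j * |x j| := by
  unfold vnorm colSum
  simp_rw [Finset.sum_mul]
  rw [Finset.sum_comm]
  refine Finset.sum_le_sum fun i _ => ?_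
  simp only [Matrix.mulVec, dotProduct]
  refine (Finset.abs_sum_le_sum_abs _ _).trans (le_of_eq ?_)
  simp_rw [abs_mul]

lemma colSum_le_iSup (g : Matrix (Fin d) (Fin d) ℝ) (j : Fin d) : colSum g j ≤ ⨆ j, colSum g j :=
  le_ciSup (Set.finite_range _).bddAbove j

lemma vnorm_mulVec_le_iSup (g : Matrix (Fin d) (Fin d) ℝ) (x : Fin d → ℝ) :
    vnorm (g *ᵥ x) ≤ (⨆ j, colSum g j) * vnorm x := by
  refine (vnorm_mulVec_le_sum g x).trans ?_
  unfold vnorm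
  rw [Finset.mul_sum]
  exact Finset.sum_le_sum fun j _ =>
    mul_le_mul_of_nonneg_right (colSum_le_iSup g j) (abs_nonneg _)

/-- On the simplex `|g x|` is at most a weighted mean of the column sums, and vertices attain them.
The finite supremum makes measurability and submultiplicative bounds immediate. -/
lemma opNorm_eq_iSup_colSum (hd : 1 ≤ d) (g : Matrix (Fin d) (Fin d) ℝ) :
    opNorm g = ⨆ j, colSum g j := by
  have : Nonempty (Fin d) := ⟨⟨0, hd⟩⟩
  have hb : ∀ x : stdSimplex ℝ (Fin d), vnorm (g *ᵥ (x : Fin d → ℝ)) ≤ ⨆ j, colSum g j := by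
    intro x
    simpa [vnorm_coe_stdSimplex x] using vnorm_mulVec_le_iSup g x
  have : Nonempty (stdSimplex ℝ (Fin d)) := ⟨⟨_, single_mem_stdSimplex ℝ (⟨0, hd⟩ : Fin d)⟩⟩
  refine le_antisymm (ciSup_le hb) (ciSup_le fun j => ?_)
  have h := le_ciSup (f := fun x : stdSimplex ℝ (Fin d) => vnorm (g *ᵥ (x : Fin d → ℝ)))
    ⟨_, Set.forall_mem_range.2 hb⟩ ⟨_, single_mem_stdSimplex ℝ j⟩
  refine le_trans (le_of_eq ?_) h
  simp [vnorm, colSum]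

lemma opNorm_nonneg (g : Matrix (Fin d) (Fin d) ℝ) : 0 ≤ opNorm g :=
  Real.iSup_nonneg fun _ => vnorm_nonneg _

lemma vnorm_mulVec_le (hd : 1 ≤ d) (g : Matrix (Fin d) (Fin d) ℝ) (x : Fin d → ℝ) :
    vnorm (g *ᵥ x) ≤ opNorm g * vnorm x := by
  rw [opNorm_eq_iSup_colSum hd]; exact vnorm_mulVec_le_iSup g x

lemma opNorm_mul_le (hd : 1 ≤ d) (g h : Matrix (Fin d) (Fin d) ℝ) :
    opNorm (g * h) ≤ opNorm g * opNorm h := by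
  have : Nonempty (stdSimplex ℝ (Fin d)) := ⟨⟨_, single_mem_stdSimplex ℝ (⟨0, hd⟩ : Fin d)⟩⟩
  refine ciSup_le fun x => ?_
  rw [← Matrix.mulVec_mulVec]
  refine (vnorm_mulVec_le hd g _).trans (mul_le_mul_of_nonneg_left ?_ (opNorm_nonneg g))
  simpa [vnorm_coe_stdSimplex x] using vnorm_mulVec_le hd h x

lemma opNorm_one (hd : 1 ≤ d) : opNorm (1 : Matrix (Fin d) (Fin d) ℝ) = 1 := by
  have : Nonempty (stdSimplex ℝ (Fin d)) := ⟨⟨_, single_mem_stdSimplex ℝ (⟨0, hd⟩ : Fin d)⟩⟩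
  have : ∀ x : stdSimplex ℝ (Fin d), vnorm ((1 : Matrix (Fin d) (Fin d) ℝ) *ᵥ (x : Fin d → ℝ)) = 1 :=
    fun x => by rw [Matrix.one_mulVec, vnorm_coe_stdSimplex]
  unfold opNorm
  simp_rw [this, ciSup_const]

lemma measurable_opNorm (hd : 1 ≤ d) :
    Measurable (opNorm : Matrix (Fin d) (Fin d) ℝ → ℝ) := by
  rw [show (opNorm : Matrix (Fin d) (Fin d) ℝ → ℝ) = fun g => ⨆ j, colSum g j from
    funext (opNorm_eq_iSup_colSum hd)]
  refine Measurable.iSup fun j => ?_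
  have : Continuous fun g : Matrix (Fin d) (Fin d) ℝ => colSum g j := by
    unfold colSum; fun_prop
  exact this.measurable

/-- The sum of the absolute values of the entries. -/
noncomputable def entrySum (g : Matrix (Fin d) (Fin d) ℝ) : ℝ := ∑ j, colSum g j

lemma opNorm_le_entrySum (hd : 1 ≤ d) (g : Matrix (Fin d) (Fin d) ℝ) :
    opNorm g ≤ entrySum g := by
  have : Nonempty (Fin d) := ⟨⟨0, hd⟩⟩
  rw [opNorm_eq_iSup_colSum hd]
  exact ciSup_le fun j => Finset.single_le_sum (f := colSum g) (fun j _ => colSum_nonneg g j)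
    (Finset.mem_univ j)

lemma entrySum_le (hd : 1 ≤ d) (g : Matrix (Fin d) (Fin d) ℝ) : entrySum g ≤ d * opNorm g := by
  rw [opNorm_eq_iSup_colSum hd]
  refine (Finset.sum_le_card_nsmul _ _ _ fun j _ => colSum_le_iSup g j).trans ?_
  simp

lemma entrySum_transpose (g : Matrix (Fin d) (Fin d) ℝ) : entrySum gᵀ = entrySum g := by
  unfold entrySum colSum
  rw [Finset.sum_comm]; rfl

/-- The sum of all entries is invariant under transposition and lies between `opNorm g` and `d *
opNorm g`; this is the source of the factor `d`. -/
lemma vnorm_transpose_mulVec_le (hd : 1 ≤ d) (g : Matrix (Fin d) (Fin d) ℝ) (x : Fin d → ℝ) :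
    vnorm (gᵀ *ᵥ x) ≤ d * opNorm g * vnorm x := by
  refine (vnorm_mulVec_le hd _ x).trans (mul_le_mul_of_nonneg_right ?_ (vnorm_nonneg x))
  exact (opNorm_le_entrySum hd _).trans ((entrySum_transpose g).le.trans (entrySum_le hd g))

lemma mulVec_nonneg {g : Matrix (Fin d) (Fin d) ℝ} {x : Fin d → ℝ} (hg : ∀ i j, 0 ≤ g i j)
    (hx : ∀ i, 0 ≤ x i) (i : Fin d) : 0 ≤ (g *ᵥ x) i := by
  simp only [Matrix.mulVec, dotProduct]
  exact Finset.sum_nonneg fun j _ => mul_nonneg (hg i j) (hx j)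

lemma mul_nonneg_entries {g h : Matrix (Fin d) (Fin d) ℝ} (hg : ∀ i j, 0 ≤ g i j)
    (hh : ∀ i j, 0 ≤ h i j) (i j : Fin d) : 0 ≤ (g * h) i j := by
  rw [Matrix.mul_apply]
  exact Finset.sum_nonneg fun k _ => mul_nonneg (hg i k) (hh k j)

lemma dotProduct_nonneg' {x y : Fin d → ℝ} (hx : ∀ i, 0 ≤ x i) (hy : ∀ i, 0 ≤ y i) :
    0 ≤ x ⬝ᵥ y := Finset.sum_nonneg fun j _ => mul_nonneg (hx j) (hy j)

lemma dotProduct_le_vnorm {x y : Fin d → ℝ} (hy : y ∈ stdSimplex ℝ (Fin d)) :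
    x ⬝ᵥ y ≤ vnorm x := by
  unfold vnorm dotProduct
  refine Finset.sum_le_sum fun i _ => (le_abs_self _).trans ?_
  rw [abs_mul]
  refine mul_le_of_le_one_right (abs_nonneg _) ?_
  rw [abs_of_nonneg (hy.1 i), ← hy.2]
  exact Finset.single_le_sum (fun i _ => hy.1 i) (Finset.mem_univ i)

lemma continuous_mulVec :
    Continuous fun p : Matrix (Fin d) (Fin d) ℝ × (Fin d → ℝ) => p.1 *ᵥ p.2 := by fun_prop

lemma continuous_transpose_mulVec :
    Continuous fun p : Matrix (Fin d) (Fin d) ℝ × (Fin d → ℝ) => p.1ᵀ *ᵥ p.2 := by fun_prop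

instance matrixMeasurableMul₂ : MeasurableMul₂ (Matrix (Fin d) (Fin d) ℝ) :=
  ⟨(continuous_fst.mul continuous_snd : Continuous fun p : Matrix (Fin d) (Fin d) ℝ ×
    Matrix (Fin d) (Fin d) ℝ => p.1 * p.2).measurable⟩

end

/-! ### Growth rates of the moments of matrix products. -/

section

/-- Fekete's lemma for submultiplicative sequences. -/
lemma tendsto_rpow_inv_of_submultiplicative {u : ℕ → ℝ} (h0 : ∀ n, 0 ≤ u n) (hu0 : 1 ≤ u 0)
    (hmul : ∀ m n, u (m + n) ≤ u m * u n) :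
    ∃ l : ℝ, 0 ≤ l ∧ Tendsto (fun n : ℕ => u n ^ (1 / (n : ℝ))) atTop (𝓝 l) ∧
      ∀ n, l ^ n ≤ u n := by
  -- The limit is the infimum over `n ≥ 1`; the shift excludes `n = 0`, where the exponent `1 / 0`
  -- is `0`. The bound `l ^ n ≤ u n` is then built in.
  set w : ℕ → ℝ := fun n => u (n + 1) ^ (1 / ((n + 1 : ℕ) : ℝ)) with hw
  have hw0 : ∀ n, 0 ≤ w n := fun n => Real.rpow_nonneg (h0 _) _
  have hbdd : BddBelow (Set.range w) := ⟨0, by rintro _ ⟨n, rfl⟩; exact hw0 n⟩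
  have hle : ∀ n, (⨅ n, w n) ≤ w n := fun n => ciInf_le hbdd n
  have hl0 : 0 ≤ ⨅ n, w n := le_ciInf hw0
  refine ⟨⨅ n, w n, hl0, ?_, ?_⟩
  · refine tendsto_order.2 ⟨fun a ha => ?_, fun b hb => ?_⟩
    · filter_upwards [eventually_ge_atTop 1] with n hn
      obtain ⟨m, rfl⟩ : ∃ m, n = m + 1 := ⟨n - 1, by omega⟩
      exact ha.trans_le (hle m)
    · have hb0 : 0 < b := hl0.trans_lt hb
      obtain ⟨m, hm⟩ := exists_lt_of_ciInf_lt hb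
      -- A zero of `u` propagates to all later indices; otherwise `log u` is subadditive.
      by_cases hz : ∃ k, u k = 0
      · obtain ⟨k, hk⟩ := hz
        filter_upwards [eventually_ge_atTop (k + 1)] with n hn
        have hun : u n = 0 := by
          refine le_antisymm ?_ (h0 n)
          have := hmul k (n - k)
          rwa [hk, zero_mul, Nat.add_sub_cancel' (by omega)] at this
        rw [hun, Real.zero_rpow]
        · exact hb0
        · have : (n : ℝ) ≠ 0 := by exact_mod_cast (by omega : n ≠ 0)
          positivity
      · push Not at hz
        have hpos : ∀ n, 0 < u n := fun n => (h0 n).lt_of_ne (hz n).symm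
        have hsub : Subadditive fun n => Real.log (u n) := fun p q => by
          rw [← Real.log_mul (hz p) (hz q)]
          exact Real.log_le_log (hpos _) (hmul p q)
        have hlog : ∀ n : ℕ, n ≠ 0 →
            (u n ^ (1 / (n : ℝ)) < b ↔ Real.log (u n) / n < Real.log b) := by
          intro n hn
          rw [← Real.log_lt_log_iff (Real.rpow_pos_of_pos (hpos n) _) hb0,
            Real.log_rpow (hpos n), one_div, div_eq_inv_mul]
        have := hsub.eventually_div_lt_of_div_lt (Nat.succ_ne_zero m)
          ((hlog _ (Nat.succ_ne_zero m)).1 hm)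
        filter_upwards [this, eventually_ge_atTop 1] with n hn hn1
        exact (hlog n (by omega)).2 hn
  · intro n
    rcases n with _ | n
    · simpa using hu0
    · refine (pow_le_pow_left₀ hl0 (hle n) _).trans (le_of_eq ?_)
      rw [hw, ← Real.rpow_natCast, ← Real.rpow_mul (h0 _)]
      rw [one_div, inv_mul_cancel₀ (by positivity), Real.rpow_one]

variable {d : ℕ}

/-- The law of a product of `n` independent matrices with law `μ`. -/
noncomputable def convPow (μ : Measure (Matrix (Fin d) (Fin d) ℝ)) :
    ℕ → Measure (Matrix (Fin d) (Fin d) ℝ)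
  | 0 => Measure.dirac 1
  | n + 1 => convPow μ n ∗ₘ μ

section

variable (μ : Measure (Matrix (Fin d) (Fin d) ℝ)) [IsProbabilityMeasure μ]

instance isProbabilityMeasure_convPow (n : ℕ) : IsProbabilityMeasure (convPow μ n) := by
  induction n with
  | zero => unfold convPow; infer_instance
  | succ n ih => unfold convPow; infer_instance

lemma convPow_add (m n : ℕ) : convPow μ (m + n) = convPow μ m ∗ₘ convPow μ n := by
  induction n with
  | zero => simp [convPow]
  | succ n ih => rw [← add_assoc, convPow, convPow, ih, Measure.mconv_assoc]

lemma measurableSet_nonneg_entries :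
    MeasurableSet {g : Matrix (Fin d) (Fin d) ℝ | ∀ i j, 0 ≤ g i j} := by
  have : IsClosed {g : Matrix (Fin d) (Fin d) ℝ | ∀ i j, 0 ≤ g i j} := by
    simp only [Set.ofPred_forall]
    exact isClosed_iInter fun i => isClosed_iInter fun j =>
      isClosed_le continuous_const (by fun_prop)
  exact this.measurableSet

omit [IsProbabilityMeasure μ] in
lemma ae_convPow_nonneg (hμ : ∀ᵐ g ∂μ, ∀ i j, 0 ≤ g i j) (n : ℕ) :
    ∀ᵐ g ∂convPow μ n, ∀ i j, 0 ≤ g i j := by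
  have hmeas := measurableSet_nonneg_entries (d := d)
  induction n with
  | zero =>
    rw [convPow, ae_dirac_iff hmeas]
    intro i j
    rw [Matrix.one_apply]; split_ifs <;> norm_num
  | succ n ih =>
    rw [convPow, Measure.mconv, ae_map_iff measurable_mul.aemeasurable hmeas]
    have h1 := Measure.quasiMeasurePreserving_fst (μ := convPow μ n) (ν := μ) |>.ae ih
    have h2 := Measure.quasiMeasurePreserving_snd (μ := convPow μ n) (ν := μ) |>.ae hμ
    filter_upwards [h1, h2] with p hp1 hp2
    exact mul_nonneg_entries hp1 hp2

/-- `E ‖Π_n‖ ^ s`, with values in `[0, ∞]`. -/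
noncomputable def moment (s : ℝ) (n : ℕ) : ℝ≥0∞ :=
  ∫⁻ g, ENNReal.ofReal (opNorm g) ^ s ∂convPow μ n

variable {μ}

lemma measurable_ofReal_opNorm_rpow (hd : 1 ≤ d) (s : ℝ) :
    Measurable fun g : Matrix (Fin d) (Fin d) ℝ => ENNReal.ofReal (opNorm g) ^ s :=
  (measurable_opNorm hd).ennreal_ofReal.pow_const s

omit [IsProbabilityMeasure μ] in
lemma moment_zero (hd : 1 ≤ d) (s : ℝ) : moment μ s 0 = 1 := by
  rw [moment, convPow, lintegral_dirac' _ (measurable_ofReal_opNorm_rpow hd s), opNorm_one hd]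
  simp

lemma moment_add_le (hd : 1 ≤ d) {s : ℝ} (hs : 0 ≤ s) (m n : ℕ) :
    moment μ s (m + n) ≤ moment μ s m * moment μ s n := by
  have hmeas := measurable_ofReal_opNorm_rpow hd s
  rw [moment, convPow_add, Measure.lintegral_mconv_eq_lintegral_prod hmeas, moment, moment,
    ← lintegral_prod_mul hmeas.aemeasurable hmeas.aemeasurable]
  refine lintegral_mono fun p => ?_
  rw [← ENNReal.mul_rpow_of_nonneg _ _ hs, ← ENNReal.ofReal_mul (opNorm_nonneg _)]
  exact ENNReal.rpow_le_rpow (ENNReal.ofReal_le_ofReal (opNorm_mul_le hd _ _)) hs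

lemma moment_one (s : ℝ) : moment μ s 1 = ∫⁻ g, ENNReal.ofReal (opNorm g) ^ s ∂μ := by
  rw [moment, convPow, convPow, Measure.dirac_one_mconv]

lemma moment_lt_top (hd : 1 ≤ d) {s : ℝ} (hs : 0 ≤ s) (h1 : moment μ s 1 < ∞) (n : ℕ) :
    moment μ s n < ∞ := by
  induction n with
  | zero => simp [moment_zero hd]
  | succ n ih => exact (moment_add_le hd hs n 1).trans_lt (ENNReal.mul_lt_top ih h1)

lemma moment_one_lt_top {s : ℝ} (hs : s ∈ momentSet μ) : moment μ s 1 < ∞ := by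
  rw [moment_one]
  have := hs.2.lintegral_lt_top
  simpa only [ENNReal.ofReal_rpow_of_nonneg (opNorm_nonneg _) hs.1] using this

omit [IsProbabilityMeasure μ] in
-- Hölder's inequality: the moments are log-convex in the exponent, a property that their growth
-- rates inherit.
lemma moment_le_rpow_mul_rpow (hd : 1 ≤ d) {a b p q : ℝ} (hp : 0 ≤ p) (hq : 0 ≤ q)
    (hpq : p + q = 1) (ha : 0 ≤ a) (hb : 0 ≤ b) (n : ℕ) :
    moment μ (p * a + q * b) n ≤ moment μ a n ^ p * moment μ b n ^ q := by
  refine le_trans (le_of_eq ?_) (ENNReal.lintegral_mul_norm_pow_le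
    (measurable_ofReal_opNorm_rpow hd a).aemeasurable
    (measurable_ofReal_opNorm_rpow hd b).aemeasurable hp hq hpq)
  refine lintegral_congr fun g => ?_
  rw [← ENNReal.rpow_mul, ← ENNReal.rpow_mul,
    ← ENNReal.rpow_add_of_nonneg _ _ (by positivity) (by positivity), mul_comm p, mul_comm q]

lemma exists_growth_rate (hd : 1 ≤ d) {s : ℝ} (hs : s ∈ momentSet μ) :
    ∃ l : ℝ, 0 ≤ l ∧
      Tendsto (fun n : ℕ => (moment μ s n).toReal ^ (1 / (n : ℝ))) atTop (𝓝 l) ∧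
      ∀ n, l ^ n ≤ (moment μ s n).toReal := by
  have hfin := moment_lt_top hd hs.1 (moment_one_lt_top hs)
  refine tendsto_rpow_inv_of_submultiplicative (fun _ => ENNReal.toReal_nonneg)
    (by simp [moment_zero hd]) fun m n => ?_
  rw [← ENNReal.toReal_mul]
  exact ENNReal.toReal_mono (ENNReal.mul_lt_top (hfin m) (hfin n)).ne (moment_add_le hd hs.1 m n)

lemma momentSet_of_le (hd : 1 ≤ d) {t s : ℝ} (ht : 0 ≤ t) (hts : t ≤ s) (hs : s ∈ momentSet μ) :
    t ∈ momentSet μ := by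
  refine ⟨ht, Integrable.mono' (hs.2.add (integrable_const 1))
    ((measurable_opNorm hd).pow_const t).aestronglyMeasurable (ae_of_all _ fun g => ?_)⟩
  have h0 := opNorm_nonneg g
  rw [Real.norm_of_nonneg (Real.rpow_nonneg h0 t)]
  simp only [Pi.add_apply]
  rcases le_total (opNorm g) 1 with h | h
  · exact (Real.rpow_le_one h0 h ht).trans (by linarith [Real.rpow_nonneg h0 s])
  · exact (Real.rpow_le_rpow_of_exponent_le h hts).trans (by linarith)

end

end

/-! ### Log-convexity of the growth rate and its value beyond `α`. -/

section

section

variable {d : ℕ} {μ : Measure (Matrix (Fin d) (Fin d) ℝ)} [IsProbabilityMeasure μ]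

lemma moment_exponent_zero (n : ℕ) : moment μ 0 n = 1 := by simp [moment]

/-- Convexity between `0` and `a` gives `lt ≤ 1`, so `lt < 1`. Since `a` lies between `t` and `s`, a
value `ls ≤ 1` would force the growth rate at `a` below `1`. -/
lemma one_lt_growth_rate (hd : 1 ≤ d) {t a s lt ls : ℝ} (ht : 0 < t) (hta : t < a) (has : a < s)
    (hs : s ∈ momentSet μ)
    (hlt : Tendsto (fun n : ℕ => (moment μ t n).toReal ^ (1 / (n : ℝ))) atTop (𝓝 lt))
    (hla : Tendsto (fun n : ℕ => (moment μ a n).toReal ^ (1 / (n : ℝ))) atTop (𝓝 1))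
    (hls : Tendsto (fun n : ℕ => (moment μ s n).toReal ^ (1 / (n : ℝ))) atTop (𝓝 ls))
    (h1 : lt ≠ 1) : 1 < ls := by
  have ha : 0 < a := ht.trans hta
  have hs0 : 0 < s := ha.trans has
  have hfin : ∀ r, 0 ≤ r → r ≤ s → ∀ n, moment μ r n < ∞ := fun r hr hrs =>
    moment_lt_top hd hr (moment_one_lt_top (momentSet_of_le hd hr hrs hs))
  have hholder : ∀ {a b p q : ℝ}, 0 ≤ p → 0 ≤ q → p + q = 1 → 0 ≤ a → a ≤ s → 0 ≤ b → b ≤ s →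
      ∀ n : ℕ, (moment μ (p * a + q * b) n).toReal ^ (1 / (n : ℝ)) ≤
        ((moment μ a n).toReal ^ (1 / (n : ℝ))) ^ p *
          ((moment μ b n).toReal ^ (1 / (n : ℝ))) ^ q := by
    intro a b p q hp hq hpq ha has hb hbs n
    have h := ENNReal.toReal_mono (ENNReal.mul_lt_top
      (ENNReal.rpow_lt_top_of_nonneg hp (hfin a ha has n).ne)
      (ENNReal.rpow_lt_top_of_nonneg hq (hfin b hb hbs n).ne)).ne
      (moment_le_rpow_mul_rpow (μ := μ) hd hp hq hpq ha hb n)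
    rw [ENNReal.toReal_mul, ← ENNReal.toReal_rpow, ← ENNReal.toReal_rpow] at h
    refine (Real.rpow_le_rpow ENNReal.toReal_nonneg h (by positivity)).trans (le_of_eq ?_)
    rw [Real.mul_rpow (by positivity) (by positivity)]
    simp_rw [← Real.rpow_mul ENNReal.toReal_nonneg, mul_comm]
  have hlt0 : 0 ≤ lt := ge_of_tendsto' hlt fun n => by positivity
  have hls0 : 0 ≤ ls := ge_of_tendsto' hls fun n => by positivity
  have hlt1 : lt ≤ 1 := by
    have hp : 0 ≤ t / a := by positivity
    have hq : 0 ≤ 1 - t / a := sub_nonneg.2 ((div_le_one ha).2 hta.le)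
    have hlim := hla.rpow_const (p := t / a) (Or.inl one_ne_zero)
    rw [Real.one_rpow] at hlim
    refine le_of_tendsto_of_tendsto' hlt hlim fun n => ?_
    have := hholder hp hq (by ring) ha.le has.le le_rfl hs0.le n
    rw [moment_exponent_zero] at this
    have he : t / a * a + (1 - t / a) * 0 = t := by field_simp; ring
    rw [he] at this
    simpa using this
  by_contra hcon
  push Not at hcon
  -- The weight for which `a = p * t + (1 - p) * s`.
  set p := (s - a) / (s - t) with hp
  have hst : 0 < s - t := by linarith
  have hp0 : 0 < p := div_pos (by linarith) hst
  have hq0 : 0 ≤ 1 - p := by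
    rw [sub_nonneg, hp, div_le_one hst]; linarith
  have key : (1 : ℝ) ≤ lt ^ p * ls ^ (1 - p) := by
    refine le_of_tendsto_of_tendsto' hla
      ((hlt.rpow_const (Or.inr hp0.le)).mul (hls.rpow_const (Or.inr hq0))) fun n => ?_
    have := hholder hp0.le hq0 (by ring) ht.le (hta.trans has).le hs0.le le_rfl n
    have he : p * t + (1 - p) * s = a := by rw [hp]; field_simp; ring
    rwa [he] at this
  have h2 : lt ^ p < 1 := Real.rpow_lt_one hlt0 (lt_of_le_of_ne hlt1 h1) hp0
  have h3 : ls ^ (1 - p) ≤ 1 := Real.rpow_le_one hls0 hcon hq0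
  have h4 : lt ^ p * ls ^ (1 - p) ≤ lt ^ p := mul_le_of_le_one_right (by positivity) h3
  linarith

end

/-! ### Laws of the products, the perpetuity and the forward process. -/

section

variable {Ω : Type*} {d : ℕ}

lemma measurable_prodMat {mΩ : MeasurableSpace Ω} {M : ℕ → Ω → Matrix (Fin d) (Fin d) ℝ} {n : ℕ}
    (hM : ∀ i < n, Measurable (M i)) : Measurable (prodMat M n) := by
  induction n with
  | zero => exact measurable_const
  | succ n ih => exact (ih fun i hi => hM i (by omega)).mul (hM n (by omega))

lemma measurable_mulVec {mΩ : MeasurableSpace Ω} {A : Ω → Matrix (Fin d) (Fin d) ℝ}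
    {v : Ω → Fin d → ℝ} (hA : Measurable A) (hv : Measurable v) :
    Measurable fun ω => A ω *ᵥ v ω :=
  continuous_mulVec.measurable.comp (hA.prodMk hv)

lemma measurable_perp {mΩ : MeasurableSpace Ω} {M : ℕ → Ω → Matrix (Fin d) (Fin d) ℝ}
    {Q : ℕ → Ω → Fin d → ℝ} {n : ℕ} (hM : ∀ i < n, Measurable (M i))
    (hQ : ∀ i < n, Measurable (Q i)) : Measurable (perp M Q n) := by
  unfold perp
  refine Finset.measurable_sum _ fun k hk => ?_
  have hk := Finset.mem_range.1 hk
  exact measurable_mulVec (measurable_prodMat fun i hi => hM i (by omega)) (hQ k hk)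

lemma measurable_forward {mΩ : MeasurableSpace Ω} {M : ℕ → Ω → Matrix (Fin d) (Fin d) ℝ}
    {Q : ℕ → Ω → Fin d → ℝ} {n : ℕ} (hM : ∀ i < n, Measurable (M i))
    (hQ : ∀ i < n, Measurable (Q i)) : Measurable (forward M Q n) := by
  induction n with
  | zero => exact measurable_const
  | succ n ih =>
    exact (measurable_mulVec (hM n (by omega)) (ih (fun i hi => hM i (by omega))
      fun i hi => hQ i (by omega))).add (hQ n (by omega))

lemma forward_nonneg {M : ℕ → Ω → Matrix (Fin d) (Fin d) ℝ} {Q : ℕ → Ω → Fin d → ℝ}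
    (hM0 : ∀ n ω i j, 0 ≤ M n ω i j) (hQ0 : ∀ n ω i, 0 ≤ Q n ω i) (n : ℕ) (ω : Ω) (i : Fin d) :
    0 ≤ forward M Q n ω i := by
  induction n generalizing i with
  | zero => simp [forward]
  | succ n ih => exact add_nonneg (mulVec_nonneg (hM0 n ω) ih i) (hQ0 n ω i)

lemma prodMat_succ' (M : ℕ → Ω → Matrix (Fin d) (Fin d) ℝ) (n : ℕ) (ω : Ω) :
    prodMat M (n + 1) ω = M 0 ω * prodMat (fun i => M (i + 1)) n ω := by
  induction n with
  | zero => simp [prodMat]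
  | succ n ih => rw [prodMat, ih, prodMat, mul_assoc]

/-- The perpetuity peels off its first pair, the forward process its last. In both cases the removed
pair is independent of the rest, so both laws obey the recursion of `affineLaw`. -/
lemma perp_succ' (M : ℕ → Ω → Matrix (Fin d) (Fin d) ℝ) (Q : ℕ → Ω → Fin d → ℝ) (n : ℕ) (ω : Ω) :
    perp M Q (n + 1) ω =
      M 0 ω *ᵥ perp (fun i => M (i + 1)) (fun i => Q (i + 1)) n ω + Q 0 ω := by
  unfold perp
  rw [Finset.sum_range_succ', Matrix.mulVec_sum]
  simp only [prodMat_succ', Matrix.mulVec_mulVec]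
  simp [prodMat]

/-- The law after `n` steps of the Markov chain `v ↦ g v + q`, with `(g, q)` drawn from `Θ`,
started at `0`. -/
noncomputable def affineLaw (Θ : Measure (Matrix (Fin d) (Fin d) ℝ × (Fin d → ℝ))) :
    ℕ → Measure (Fin d → ℝ)
  | 0 => Measure.dirac 0
  | n + 1 => (Θ.prod (affineLaw Θ n)).map fun p => p.1.1 *ᵥ p.2 + p.1.2

/-- The sigma-algebra generated by the pairs with indices in `S`. -/
abbrev coordAlgebra (M : ℕ → Ω → Matrix (Fin d) (Fin d) ℝ) (Q : ℕ → Ω → Fin d → ℝ) (S : Set ℕ) :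
    MeasurableSpace Ω :=
  ⨆ i ∈ S, MeasurableSpace.comap (fun ω => (M i ω, Q i ω)) inferInstance

lemma measurable_coords (M : ℕ → Ω → Matrix (Fin d) (Fin d) ℝ) (Q : ℕ → Ω → Fin d → ℝ)
    {S : Set ℕ} {i : ℕ} (hi : i ∈ S) :
    Measurable[coordAlgebra M Q S] (M i) ∧ Measurable[coordAlgebra M Q S] (Q i) := by
  have h : Measurable[coordAlgebra M Q S] (fun ω => (M i ω, Q i ω)) :=
    Measurable.of_comap_le (le_iSup₂_of_le i hi le_rfl)
  exact ⟨measurable_fst.comp h, measurable_snd.comp h⟩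

variable [mΩ : MeasurableSpace Ω] {P : Measure Ω} [IsProbabilityMeasure P]
  {M : ℕ → Ω → Matrix (Fin d) (Fin d) ℝ} {Q : ℕ → Ω → Fin d → ℝ}

lemma measurable_affine : Measurable
    fun p : (Matrix (Fin d) (Fin d) ℝ × (Fin d → ℝ)) × (Fin d → ℝ) => p.1.1 *ᵥ p.2 + p.1.2 := by
  have : Continuous fun p : (Matrix (Fin d) (Fin d) ℝ × (Fin d → ℝ)) × (Fin d → ℝ) =>
    p.1.1 *ᵥ p.2 + p.1.2 := by fun_prop
  exact this.measurable

omit [IsProbabilityMeasure P] in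
/-- A random element measurable with respect to the pairs with indices in `S` is independent of
the pair with an index outside of `S`. -/
lemma indepFun_of_measurable_coordAlgebra {β : Type*} [MeasurableSpace β]
    (hM : ∀ i, Measurable (M i)) (hQ : ∀ i, Measurable (Q i))
    (hindep : iIndepFun (fun n ω => (M n ω, Q n ω)) P) {S : Set ℕ} {k : ℕ} (hk : k ∉ S) {Y : Ω → β}
    (hY : Measurable[coordAlgebra M Q S] Y) :
    IndepFun (fun ω => (M k ω, Q k ω)) Y P := by
  have h := indep_iSup_of_disjoint (fun i => ((hM i).prodMk (hQ i)).comap_le) hindep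
    (S := {k}) (T := S) (Set.disjoint_singleton_left.2 hk)
  rw [IndepFun_iff_Indep]
  refine indep_of_indep_of_le_right (indep_of_indep_of_le_left h ?_) hY.comap_le
  exact le_iSup₂_of_le k rfl le_rfl

lemma map_forward (hM : ∀ i, Measurable (M i)) (hQ : ∀ i, Measurable (Q i))
    (hindep : iIndepFun (fun n ω => (M n ω, Q n ω)) P)
    {Θ : Measure (Matrix (Fin d) (Fin d) ℝ × (Fin d → ℝ))}
    (hlaw : ∀ n, P.map (fun ω => (M n ω, Q n ω)) = Θ) (n : ℕ) :
    P.map (forward M Q n) = affineLaw Θ n := by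
  induction n with
  | zero =>
    rw [show forward M Q 0 = fun _ => 0 from rfl, Measure.map_const]
    simp [affineLaw]
  | succ n ih =>
    have hY := measurable_forward (M := M) (Q := Q) (n := n)
      (mΩ := coordAlgebra M Q (Set.Iio n))
      (fun i hi => (measurable_coords M Q (Set.mem_Iio.2 hi)).1) (fun i hi => (measurable_coords M Q (Set.mem_Iio.2 hi)).2)
    have hind := indepFun_of_measurable_coordAlgebra hM hQ hindep (k := n) (by simp) hY
    have hXm : Measurable fun ω => (M n ω, Q n ω) := (hM n).prodMk (hQ n)
    have hfm : Measurable (forward M Q n) := measurable_forward (fun i _ => hM i) fun i _ => hQ i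
    rw [affineLaw, ← ih, ← hlaw n, ← (indepFun_iff_map_prod_eq_prod_map_map hXm.aemeasurable
      hfm.aemeasurable).1 hind, Measure.map_map measurable_affine (hXm.prodMk hfm)]
    rfl

lemma map_perp (hM : ∀ i, Measurable (M i)) (hQ : ∀ i, Measurable (Q i))
    (hindep : iIndepFun (fun n ω => (M n ω, Q n ω)) P)
    {Θ : Measure (Matrix (Fin d) (Fin d) ℝ × (Fin d → ℝ))}
    (hlaw : ∀ n, P.map (fun ω => (M n ω, Q n ω)) = Θ) (n : ℕ) :
    P.map (perp M Q n) = affineLaw Θ n := by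
  induction n generalizing M Q with
  | zero =>
    rw [show perp M Q 0 = fun _ => 0 from funext fun ω => by simp [perp], Measure.map_const]
    simp [affineLaw]
  | succ n ih =>
    have ih' := ih (M := fun i => M (i + 1)) (Q := fun i => Q (i + 1)) (fun i => hM _)
      (fun i => hQ _) (hindep.precomp (g := fun i => i + 1) (add_left_injective 1))
      (fun i => hlaw _)
    have hY := measurable_perp (M := fun i => M (i + 1)) (Q := fun i => Q (i + 1)) (n := n)
      (mΩ := coordAlgebra M Q (Set.Ioi 0))
      (fun i hi => (measurable_coords M Q (Set.mem_Ioi.2 i.succ_pos)).1)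
      (fun i hi => (measurable_coords M Q (Set.mem_Ioi.2 i.succ_pos)).2)
    have hind := indepFun_of_measurable_coordAlgebra hM hQ hindep (k := 0) (by simp) hY
    have hXm : Measurable fun ω => (M 0 ω, Q 0 ω) := (hM 0).prodMk (hQ 0)
    have hfm : Measurable (perp (fun i => M (i + 1)) (fun i => Q (i + 1)) n) :=
      measurable_perp (fun i _ => hM _) fun i _ => hQ _
    rw [affineLaw, ← ih', ← hlaw 0, ← (indepFun_iff_map_prod_eq_prod_map_map hXm.aemeasurable
      hfm.aemeasurable).1 hind, Measure.map_map measurable_affine (hXm.prodMk hfm)]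
    congr 1
    exact funext fun ω => perp_succ' M Q n ω

lemma map_prodMat (hM : ∀ i, Measurable (M i)) (hQ : ∀ i, Measurable (Q i))
    (hindep : iIndepFun (fun n ω => (M n ω, Q n ω)) P)
    {μ : Measure (Matrix (Fin d) (Fin d) ℝ)} (hlaw : ∀ n, P.map (M n) = μ) (n : ℕ) :
    P.map (prodMat M n) = convPow μ n := by
  induction n with
  | zero =>
    rw [show prodMat M 0 = fun _ => 1 from rfl, Measure.map_const]
    simp [convPow]
  | succ n ih =>
    have hY := measurable_prodMat (M := M) (n := n)
      (mΩ := coordAlgebra M Q (Set.Iio n))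
      (fun i hi => (measurable_coords M Q (Set.mem_Iio.2 hi)).1)
    have hind := ((indepFun_of_measurable_coordAlgebra hM hQ hindep (k := n) (by simp) hY).comp
      measurable_fst measurable_id).symm
    have hfm : Measurable (prodMat M n) := measurable_prodMat (fun i _ => hM i)
    have := (indepFun_iff_map_prod_eq_prod_map_map hfm.aemeasurable
      (hM n).aemeasurable).1 hind
    rw [convPow, ← ih, ← hlaw n, Measure.mconv, ← this,
      Measure.map_map measurable_mul (hfm.prodMk (hM n))]
    rfl

/-- `kappa` is a `limUnder`, meaningful only once convergence is known; this identifies it with a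
limit of moments of `convPow`, which depend on `μ` alone. -/
lemma kappa_eq_of_tendsto (hd : 1 ≤ d) (hM : ∀ i, Measurable (M i)) (hQ : ∀ i, Measurable (Q i))
    (hindep : iIndepFun (fun n ω => (M n ω, Q n ω)) P)
    {μ : Measure (Matrix (Fin d) (Fin d) ℝ)} (hlaw : ∀ n, P.map (M n) = μ) {s l : ℝ} (hs : 0 ≤ s)
    (hl : Tendsto (fun n : ℕ => (moment μ s n).toReal ^ (1 / (n : ℝ))) atTop (𝓝 l)) :
    kappa P M s = l := by
  refine Tendsto.limUnder_eq (hl.congr fun n => ?_)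
  congr 1
  have hfm : Measurable (prodMat M n) := measurable_prodMat (fun i _ => hM i)
  rw [integral_eq_lintegral_of_nonneg_ae
    (ae_of_all _ fun ω => Real.rpow_nonneg (opNorm_nonneg _) s)
    (((measurable_opNorm hd).comp hfm).pow_const s).aestronglyMeasurable,
    moment, ← map_prodMat hM hQ hindep hlaw n,
    lintegral_map (measurable_ofReal_opNorm_rpow hd s) hfm]
  simp_rw [ENNReal.ofReal_rpow_of_nonneg (opNorm_nonneg _) hs]

end

end

/-! ### The homogeneous eigenfunction: eigenvalue equation and lower bound. -/

section

variable {d : ℕ}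

lemma isClosed_simplex : IsClosed (stdSimplex ℝ (Fin d)) := (isCompact_stdSimplex ℝ (Fin d)).isClosed

/-- `∫ ⟨v, y⟩ ^ s ν(dy)`, with values in `[0, ∞]`: the `s`-homogeneous extension of `eigenfun`. -/
noncomputable def homEigenfun (s : ℝ) (ν : Measure (Fin d → ℝ)) (v : Fin d → ℝ) : ℝ≥0∞ :=
  ∫⁻ y, ENNReal.ofReal (v ⬝ᵥ y) ^ s ∂ν

lemma measurable_ofReal_dotProduct_rpow (s : ℝ) :
    Measurable fun p : (Fin d → ℝ) × (Fin d → ℝ) => ENNReal.ofReal (p.1 ⬝ᵥ p.2) ^ s := by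
  have : Continuous fun p : (Fin d → ℝ) × (Fin d → ℝ) => p.1 ⬝ᵥ p.2 := by fun_prop
  exact this.measurable.ennreal_ofReal.pow_const s

lemma measurable_homEigenfun (s : ℝ) (ν : Measure (Fin d → ℝ)) [SFinite ν] :
    Measurable (homEigenfun s ν) :=
  (measurable_ofReal_dotProduct_rpow s).lintegral_prod_right'

lemma homEigenfun_zero {s : ℝ} (hs : 0 < s) (ν : Measure (Fin d → ℝ)) :
    homEigenfun s ν 0 = 0 := by
  simp [homEigenfun, ENNReal.zero_rpow_of_pos hs]

section

variable {ν : Measure (Fin d → ℝ)} {s k : ℝ} {μ : Measure (Matrix (Fin d) (Fin d) ℝ)}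

lemma IsConjEigenmeasure.ae_mem (hν : IsConjEigenmeasure μ s k ν) :
    ∀ᵐ y ∂ν, y ∈ stdSimplex ℝ (Fin d) := hν.carried

lemma homEigenfun_le (hs : 0 ≤ s) [IsProbabilityMeasure ν]
    (hcar : ∀ᵐ y ∂ν, y ∈ stdSimplex ℝ (Fin d)) (v : Fin d → ℝ) :
    homEigenfun s ν v ≤ ENNReal.ofReal (vnorm v) ^ s := by
  calc homEigenfun s ν v ≤ ∫⁻ _, ENNReal.ofReal (vnorm v) ^ s ∂ν := by
        refine lintegral_mono_ae ?_
        filter_upwards [hcar] with y hy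
        exact ENNReal.rpow_le_rpow (ENNReal.ofReal_le_ofReal (dotProduct_le_vnorm hy)) hs
    _ = _ := by simp

lemma homEigenfun_mono (hs : 0 ≤ s) (hcar : ∀ᵐ y ∂ν, y ∈ stdSimplex ℝ (Fin d))
    {v w : Fin d → ℝ} (h : ∀ i, v i ≤ w i) : homEigenfun s ν v ≤ homEigenfun s ν w := by
  refine lintegral_mono_ae ?_
  filter_upwards [hcar] with y hy
  refine ENNReal.rpow_le_rpow (ENNReal.ofReal_le_ofReal ?_) hs
  exact Finset.sum_le_sum fun i _ => mul_le_mul_of_nonneg_right (h i) (hy.1 i)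

lemma homEigenfun_smul (hs : 0 ≤ s) {c : ℝ} (hc : 0 ≤ c) (v : Fin d → ℝ) :
    homEigenfun s ν (c • v) = ENNReal.ofReal c ^ s * homEigenfun s ν v := by
  unfold homEigenfun
  rw [← lintegral_const_mul' _ _ (ENNReal.rpow_ne_top_of_nonneg hs ENNReal.ofReal_ne_top)]
  refine lintegral_congr fun y => ?_
  rw [smul_dotProduct, smul_eq_mul, ENNReal.ofReal_mul hc, ENNReal.mul_rpow_of_nonneg _ _ hs]

/-- The eigenfunction equation `E R(M v) = k R(v)` for the homogeneous extension. -/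
lemma lintegral_homEigenfun_mulVec [IsProbabilityMeasure μ] (hd : 1 ≤ d) (hs : 0 < s)
    (hμ : ∀ᵐ g ∂μ, ∀ i j, 0 ≤ g i j) (hsI : s ∈ momentSet μ)
    (hν : IsConjEigenmeasure μ s k ν) (v : Fin d → ℝ) :
    ∫⁻ g, homEigenfun s ν (g *ᵥ v) ∂μ = ENNReal.ofReal k * homEigenfun s ν v := by
  have := hν.prob
  -- The eigenmeasure is tested against `⟨v, ·⟩₊ ^ s`, cut off to the simplex to be bounded. The
  -- positive part matches `ENNReal.ofReal`, as `v` may have any sign.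
  set ψ : (Fin d → ℝ) → ℝ := fun y => max (v ⬝ᵥ y) 0 ^ s with hψ
  have hψc : Continuous ψ := by
    have : Continuous fun y : Fin d → ℝ => max (v ⬝ᵥ y) 0 := by fun_prop
    exact this.rpow_const fun _ => Or.inr hs.le
  have hψ0 : ∀ y, 0 ≤ ψ y := fun y => Real.rpow_nonneg (le_max_right _ _) s
  have hψof : ∀ y, ENNReal.ofReal (ψ y) = ENNReal.ofReal (v ⬝ᵥ y) ^ s := fun y => by
    rw [hψ, ← ENNReal.ofReal_rpow_of_nonneg (le_max_right _ _) hs.le]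
    congr 1
    rcases le_total (v ⬝ᵥ y) 0 with h | h
    · rw [max_eq_right h, ENNReal.ofReal_of_nonpos h, ENNReal.ofReal_zero]
    · rw [max_eq_left h]
  have hψle : ∀ y ∈ stdSimplex ℝ (Fin d), ψ y ≤ vnorm v ^ s := fun y hy =>
    Real.rpow_le_rpow (le_max_right _ _) (max_le (dotProduct_le_vnorm hy) (vnorm_nonneg v)) hs.le
  -- Homogeneity absorbs the factor `|w| ^ s`, and removes the cutoff.
  have hhom : ∀ {w : Fin d → ℝ}, (∀ i, 0 ≤ w i) →
      vnorm w ^ s * (stdSimplex ℝ (Fin d)).indicator ψ (direction w) = ψ w := by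
    intro w hw
    by_cases h0 : w = 0
    · simp [h0, vnorm_zero, hψ, Real.zero_rpow hs.ne']
    · rw [Set.indicator_of_mem (direction_mem_stdSimplex hw h0), hψ,
        ← Real.mul_rpow (vnorm_nonneg _) (le_max_right _ _), mul_max_of_nonneg _ _ (vnorm_nonneg _),
        mul_zero, ← smul_eq_mul, ← dotProduct_smul, vnorm_smul_direction]
  have heig := hν.eigen ((stdSimplex ℝ (Fin d)).indicator ψ)
    (hψc.measurable.indicator isClosed_simplex.measurableSet) ⟨vnorm v ^ s, fun y => by
      by_cases hy : y ∈ stdSimplex ℝ (Fin d)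
      · rw [Set.indicator_of_mem hy, abs_of_nonneg (hψ0 y)]; exact hψle y hy
      · rw [Set.indicator_of_notMem hy, abs_zero]; exact Real.rpow_nonneg (vnorm_nonneg v) s⟩
  have hl : ∀ᵐ y ∂ν, conjTransfer μ s ((stdSimplex ℝ (Fin d)).indicator ψ) y
      = ∫ g, ψ (gᵀ *ᵥ y) ∂μ := by
    filter_upwards [hν.ae_mem] with y hy
    refine integral_congr_ae ?_
    filter_upwards [hμ] with g hg
    exact hhom (mulVec_nonneg (fun i j => hg j i) hy.1)
  have hr : ∀ᵐ y ∂ν, (stdSimplex ℝ (Fin d)).indicator ψ y = ψ y := by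
    filter_upwards [hν.ae_mem] with y hy using Set.indicator_of_mem hy ψ
  rw [integral_congr_ae hl, integral_congr_ae hr] at heig
  have hjc : Continuous fun p : (Fin d → ℝ) × Matrix (Fin d) (Fin d) ℝ => ψ (p.2ᵀ *ᵥ p.1) :=
    hψc.comp (continuous_transpose_mulVec.comp continuous_swap)
  have hint : Integrable (fun p : (Fin d → ℝ) × Matrix (Fin d) (Fin d) ℝ => ψ (p.2ᵀ *ᵥ p.1))
      (ν.prod μ) := by
    refine Integrable.mono' ((hsI.2.const_mul ((vnorm v * d) ^ s)).comp_snd ν)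
      hjc.measurable.aestronglyMeasurable ?_
    have h1 := Measure.quasiMeasurePreserving_fst (μ := ν) (ν := μ) |>.ae hν.ae_mem
    filter_upwards [h1] with p hp
    rw [Real.norm_of_nonneg (hψ0 _), ← Real.mul_rpow
      (mul_nonneg (vnorm_nonneg v) (Nat.cast_nonneg d)) (opNorm_nonneg _)]
    refine Real.rpow_le_rpow (le_max_right _ _) (max_le ?_ ?_) hs.le
    · have hb := vnorm_transpose_mulVec_le hd p.2 p.1
      rw [vnorm_of_mem_stdSimplex hp, mul_one] at hb
      refine le_trans ?_ (le_of_le_of_eq (mul_le_mul_of_nonneg_left hb (vnorm_nonneg v))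
        (mul_assoc _ _ _).symm)
      unfold dotProduct
      refine (Finset.sum_le_sum fun i _ => ?_ : _ ≤ ∑ i, vnorm v * |(p.2ᵀ *ᵥ p.1) i|).trans_eq ?_
      · refine (le_abs_self _).trans ?_
        rw [abs_mul]
        exact mul_le_mul_of_nonneg_right (abs_le_vnorm v i) (abs_nonneg _)
      · rw [← Finset.mul_sum]; rfl
    · exact mul_nonneg (mul_nonneg (vnorm_nonneg v) (Nat.cast_nonneg d)) (opNorm_nonneg _)
  have hψint : Integrable ψ ν := by
    refine Integrable.mono' (integrable_const (vnorm v ^ s)) hψc.measurable.aestronglyMeasurable ?_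
    filter_upwards [hν.ae_mem] with y hy
    rw [Real.norm_of_nonneg (hψ0 _)]; exact hψle y hy
  have hfin := congrArg ENNReal.ofReal heig
  rw [← integral_prod (fun p : (Fin d → ℝ) × Matrix (Fin d) (Fin d) ℝ => ψ (p.2ᵀ *ᵥ p.1)) hint,
    ofReal_integral_eq_lintegral_ofReal hint (ae_of_all _ fun _ => hψ0 _),
    ENNReal.ofReal_mul' (integral_nonneg hψ0),
    ofReal_integral_eq_lintegral_ofReal hψint (ae_of_all _ hψ0),
    lintegral_prod_symm _ hjc.measurable.ennreal_ofReal.aemeasurable] at hfin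
  simp_rw [hψof] at hfin
  rw [homEigenfun, ← hfin]
  -- After Fubini only the duality `⟨v, gᵀ y⟩ = ⟨g v, y⟩` remains.
  refine lintegral_congr fun g => lintegral_congr fun y => ?_
  rw [Matrix.dotProduct_mulVec, Matrix.vecMul_transpose]

/-- The nonnegative vectors orthogonal to the support of `ν`. -/
def annihilatedCone (ν : Measure (Fin d → ℝ)) : Set (Fin d → ℝ) :=
  {v | (∀ i, 0 ≤ v i) ∧ ∀ y ∈ ν.support, v ⬝ᵥ y = 0}

lemma isClosed_annihilatedCone (ν : Measure (Fin d → ℝ)) : IsClosed (annihilatedCone ν) := by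
  simp only [annihilatedCone, Set.ofPred_and, Set.ofPred_forall]
  exact (isClosed_iInter fun i => isClosed_le continuous_const (continuous_apply i)).inter
    (isClosed_iInter fun y => isClosed_iInter fun _ =>
      isClosed_eq (by fun_prop) continuous_const)

/-- It turns the vanishing of an integral into a closed condition, which passes from almost every
matrix to the support of `μ` and to the closure of a semigroup. -/
lemma homEigenfun_eq_zero_iff (hs : 0 < s) (hcar : ∀ᵐ y ∂ν, y ∈ stdSimplex ℝ (Fin d))
    {v : Fin d → ℝ} (hv : ∀ i, 0 ≤ v i) :
    homEigenfun s ν v = 0 ↔ v ∈ annihilatedCone ν := by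
  have hm : Measurable fun y : Fin d → ℝ => ENNReal.ofReal (v ⬝ᵥ y) ^ s :=
    (measurable_ofReal_dotProduct_rpow s).comp measurable_prodMk_left
  rw [homEigenfun, lintegral_eq_zero_iff hm]
  constructor
  · intro h
    refine ⟨hv, fun y hy => ?_⟩
    have hcl : IsClosed {y : Fin d → ℝ | v ⬝ᵥ y = 0} :=
      isClosed_eq (by fun_prop) continuous_const
    refine Measure.support_subset_of_isClosed hcl ?_ hy
    filter_upwards [h, hcar] with y hy hyK
    have h1 : ENNReal.ofReal (v ⬝ᵥ y) = 0 := by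
      simpa [ENNReal.rpow_eq_zero_iff, hs, hs.le.not_gt] using hy
    exact le_antisymm (ENNReal.ofReal_eq_zero.1 h1) (dotProduct_nonneg' hv hyK.1)
  · intro h
    filter_upwards [Measure.support_mem_ae (μ := ν)] with y hy
    simp [h.2 y hy, ENNReal.zero_rpow_of_pos hs]

/-- If `R(v) = 0`, the eigenvalue equation gives `R(g v) = 0` for almost every `g`. So the
annihilated cone is stable under the support of `μ` and under `Gam μ`. A positive matrix sends a
basis vector to a strictly positive vector, which is orthogonal to no point of the simplex. -/
lemma homEigenfun_single_pos [IsProbabilityMeasure μ] (hd : 1 ≤ d) (hs : 0 < s)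
    (hμ : ∀ᵐ g ∂μ, ∀ i j, 0 ≤ g i j) (hsI : s ∈ momentSet μ)
    (hpos : ∃ g ∈ Gam μ, ∀ i j, 0 < g i j)
    (hν : IsConjEigenmeasure μ s k ν) (i : Fin d) :
    0 < homEigenfun s ν (Pi.single i 1) := by
  have := hν.prob
  have hcl := isClosed_annihilatedCone ν
  have hstep : ∀ g ∈ μ.support, ∀ v ∈ annihilatedCone ν, g *ᵥ v ∈ annihilatedCone ν := by
    intro g hg v hv
    have hcl' : IsClosed {g : Matrix (Fin d) (Fin d) ℝ | g *ᵥ v ∈ annihilatedCone ν} :=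
      hcl.preimage (by fun_prop)
    refine Measure.support_subset_of_isClosed hcl' ?_ hg
    have h := lintegral_homEigenfun_mulVec hd hs hμ hsI hν v
    have hm : Measurable fun g : Matrix (Fin d) (Fin d) ℝ => homEigenfun s ν (g *ᵥ v) :=
      (measurable_homEigenfun s ν).comp (continuous_mulVec.measurable.comp measurable_prodMk_right)
    rw [(homEigenfun_eq_zero_iff hs hν.ae_mem hv.1).2 hv, mul_zero, lintegral_eq_zero_iff hm] at h
    filter_upwards [h, hμ] with g hg hg0
    exact (homEigenfun_eq_zero_iff hs hν.ae_mem (mulVec_nonneg hg0 hv.1)).1 hg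
  let S : Subsemigroup (Matrix (Fin d) (Fin d) ℝ) :=
    { carrier := {g | ∀ v ∈ annihilatedCone ν, g *ᵥ v ∈ annihilatedCone ν}
      mul_mem' := fun {a b} ha hb v hv => by
        rw [← Matrix.mulVec_mulVec]; exact ha _ (hb v hv) }
  have hScl : IsClosed (S : Set (Matrix (Fin d) (Fin d) ℝ)) := by
    change IsClosed {g : Matrix (Fin d) (Fin d) ℝ |
      ∀ v ∈ annihilatedCone ν, g *ᵥ v ∈ annihilatedCone ν}
    simp only [Set.ofPred_forall]
    exact isClosed_iInter fun v => isClosed_iInter fun _ =>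
      hcl.preimage (f := fun g : Matrix (Fin d) (Fin d) ℝ => g *ᵥ v) (by fun_prop)
  have hGam : Gam μ ≤ S :=
    Subsemigroup.topologicalClosure_minimal _ (Subsemigroup.closure_le.2 hstep) hScl
  obtain ⟨g, hg, hgpos⟩ := hpos
  have he : ∀ j, 0 ≤ (Pi.single i 1 : Fin d → ℝ) j := fun j => by
    by_cases h : j = i
    · subst h; simp
    · simp [h]
  rw [pos_iff_ne_zero]
  intro h0
  have hz := hGam hg _ ((homEigenfun_eq_zero_iff hs hν.ae_mem he).1 h0)
  obtain ⟨y, hy⟩ := Measure.nonempty_support (μ := ν) (IsProbabilityMeasure.ne_zero ν)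
  have hyK : y ∈ stdSimplex ℝ (Fin d) :=
    Measure.support_subset_of_isClosed isClosed_simplex hν.ae_mem hy
  have hcol : ∀ j, (g *ᵥ Pi.single i 1) j = g j i := fun j => by simp
  have hsum := hz.2 y hy
  simp only [dotProduct, hcol] at hsum
  rw [Finset.sum_eq_zero_iff_of_nonneg fun j _ => mul_nonneg (hgpos j i).le (hyK.1 j)] at hsum
  have hy0 : ∀ j, y j = 0 := fun j =>
    (mul_eq_zero.1 (hsum j (Finset.mem_univ j))).resolve_left (hgpos j i).ne'
  have := hyK.2
  simp [hy0] at this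

/-- A nonnegative `v` dominates `v j • e_j` for its largest coordinate `v j ≥ |v| / d`. Monotonicity
and homogeneity yield the constant `d ^ (-s) * min_i R(e_i)`. -/
lemma exists_le_homEigenfun [IsProbabilityMeasure μ] (hd : 1 ≤ d) (hs : 0 < s)
    (hμ : ∀ᵐ g ∂μ, ∀ i j, 0 ≤ g i j) (hsI : s ∈ momentSet μ)
    (hpos : ∃ g ∈ Gam μ, ∀ i j, 0 < g i j) (hν : IsConjEigenmeasure μ s k ν) :
    ∃ c : ℝ, 0 < c ∧ ∀ v : Fin d → ℝ, (∀ i, 0 ≤ v i) →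
      ENNReal.ofReal c * ENNReal.ofReal (vnorm v) ^ s ≤ homEigenfun s ν v := by
  have := hν.prob
  have : Nonempty (Fin d) := ⟨⟨0, hd⟩⟩
  obtain ⟨i₀, hi₀⟩ := Finite.exists_min fun i : Fin d => homEigenfun s ν (Pi.single i 1)
  have hfin : homEigenfun s ν (Pi.single i₀ 1) ≠ ∞ :=
    ((homEigenfun_le hs.le hν.ae_mem _).trans_lt
      (ENNReal.rpow_lt_top_of_nonneg hs.le ENNReal.ofReal_ne_top)).ne
  have hd0 : (0 : ℝ) < d := by exact_mod_cast hd
  refine ⟨(homEigenfun s ν (Pi.single i₀ 1)).toReal * ((d : ℝ)⁻¹) ^ s, mul_pos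
    (ENNReal.toReal_pos (homEigenfun_single_pos hd hs hμ hsI hpos hν i₀).ne' hfin) (by positivity),
    fun v hv => ?_⟩
  obtain ⟨j, hj⟩ := Finite.exists_max v
  have hvj : (d : ℝ)⁻¹ * vnorm v ≤ v j := by
    rw [inv_mul_le_iff₀ hd0, vnorm_of_nonneg hv]
    refine (Finset.sum_le_card_nsmul _ _ _ fun i _ => hj i).trans ?_
    simp
  have hge : homEigenfun s ν (v j • Pi.single j 1) ≤ homEigenfun s ν v := by
    refine homEigenfun_mono hs.le hν.ae_mem fun i => ?_
    by_cases h : i = j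
    · subst h; simp
    · simp [h, hv i]
  refine le_trans ?_ hge
  rw [homEigenfun_smul hs.le (hv j), ENNReal.ofReal_mul ENNReal.toReal_nonneg,
    ENNReal.ofReal_toReal hfin, mul_assoc, mul_comm,
    ← ENNReal.ofReal_rpow_of_nonneg (by positivity) hs.le, ← ENNReal.mul_rpow_of_nonneg _ _ hs.le,
    ← ENNReal.ofReal_mul (by positivity)]
  exact mul_le_mul' (ENNReal.rpow_le_rpow (ENNReal.ofReal_le_ofReal hvj) hs.le) (hi₀ j)

lemma vnorm_rpow_mul_eigenfun (hs : 0 < s) [IsProbabilityMeasure ν]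
    (hcar : ∀ᵐ y ∂ν, y ∈ stdSimplex ℝ (Fin d)) {v : Fin d → ℝ} (hv : ∀ i, 0 ≤ v i) :
    vnorm v ^ s * eigenfun s ν (direction v) = (homEigenfun s ν v).toReal := by
  rw [eigenfun, ← integral_const_mul, homEigenfun]
  have hm : Measurable fun y : Fin d → ℝ => (v ⬝ᵥ y) ^ s := by
    have : Continuous fun y : Fin d → ℝ => v ⬝ᵥ y := by fun_prop
    exact this.measurable.pow_const s
  have h1 : ∀ᵐ y ∂ν, vnorm v ^ s * (direction v ⬝ᵥ y) ^ s = (v ⬝ᵥ y) ^ s := by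
    filter_upwards [hcar] with y hy
    rw [← Real.mul_rpow (vnorm_nonneg _) (dotProduct_nonneg' (direction_nonneg hv) hy.1),
      ← smul_eq_mul, ← smul_dotProduct, vnorm_smul_direction]
  have h2 : ∀ᵐ y ∂ν, 0 ≤ (v ⬝ᵥ y) ^ s := by
    filter_upwards [hcar] with y hy
    exact Real.rpow_nonneg (dotProduct_nonneg' hv hy.1) s
  rw [integral_congr_ae h1, integral_eq_lintegral_of_nonneg_ae h2 hm.aestronglyMeasurable]
  congr 1
  refine lintegral_congr_ae ?_
  filter_upwards [hcar] with y hy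
  rw [ENNReal.ofReal_rpow_of_nonneg (dotProduct_nonneg' hv hy.1) hs.le]

end

end

/-! ### Tools for constructing the eigenmeasure. -/

section

/-- If eventually `c N ≥ ε Z N` for the partial sums `Z`, then `Z (N + 1) ≥ (1 + ε) Z N`, so `c`
grows at least like `(1 + ε) ^ N`, contradicting the bound with `ρ = 1 + ε / 2`. It makes the
boundary term of an average negligible along a subsequence even if `c` is unbounded. -/
lemma frequently_lt_mul_sum_of_subexponential {c : ℕ → ℝ} {δ D : ℝ} (hδ : 0 < δ)
    (hc : ∀ n, δ ≤ c n) (hsub : ∀ ρ : ℝ, 1 < ρ → ∀ᶠ n in atTop, c n ≤ D * ρ ^ n)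
    {ε : ℝ} (hε : 0 < ε) :
    ∃ᶠ N in atTop, c N < ε * ∑ n ∈ Finset.range N, c n := by
  intro hcon
  simp only [not_lt] at hcon
  obtain ⟨N₀, hN₀⟩ := eventually_atTop.1 (hcon.and (hsub (1 + ε / 2) (by linarith)))
  set Z : ℕ → ℝ := fun N => ∑ n ∈ Finset.range N, c n with hZ
  set N₁ := N₀ + 1
  have hZpos : 0 < Z N₁ := Finset.sum_pos (fun n _ => hδ.trans_le (hc n)) ⟨0, by simp [N₁]⟩
  have hgrow : ∀ m, (1 + ε) ^ m * Z N₁ ≤ Z (N₁ + m) := by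
    intro m
    induction m with
    | zero => simp
    | succ m ih =>
      have h1 := (hN₀ (N₁ + m) (by omega)).1
      have h2 : Z (N₁ + (m + 1)) = Z (N₁ + m) + c (N₁ + m) := by
        rw [hZ, ← add_assoc]; exact Finset.sum_range_succ _ _
      have h3 : (1 + ε) * ((1 + ε) ^ m * Z N₁) ≤ (1 + ε) * Z (N₁ + m) :=
        mul_le_mul_of_nonneg_left ih (by linarith)
      rw [h2, pow_succ]
      change ε * Z (N₁ + m) ≤ _ at h1
      linarith
  have hq : 1 < (1 + ε) / (1 + ε / 2) := by rw [one_lt_div (by linarith)]; linarith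
  have hinf := (tendsto_pow_atTop_atTop_of_one_lt hq).atTop_mul_const (mul_pos hε hZpos)
  obtain ⟨m, hm⟩ := (hinf.eventually_gt_atTop (D * (1 + ε / 2) ^ N₁)).exists
  have h1 := hN₀ (N₁ + m) (by omega)
  have h2 : ε * ((1 + ε) ^ m * Z N₁) ≤ D * (1 + ε / 2) ^ (N₁ + m) :=
    (mul_le_mul_of_nonneg_left (hgrow m) hε.le).trans (h1.1.trans h1.2)
  have h3 : 0 < (1 + ε / 2) ^ m := by positivity
  rw [div_pow, div_mul_eq_mul_div, lt_div_iff₀ h3] at hm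
  rw [pow_add] at h2
  linarith

variable {d : ℕ}

/-- The law of the direction of `W`, weighted with `|W| ^ s`. -/
noncomputable def weightedDirection {X : Type*} [MeasurableSpace X] (m : Measure X)
    (W : X → Fin d → ℝ) (s : ℝ) : Measure (Fin d → ℝ) :=
  (m.withDensity fun x => ENNReal.ofReal (vnorm (W x) ^ s)).map fun x => direction (W x)

section

variable {X : Type*} [MeasurableSpace X] {m : Measure X} {W : X → Fin d → ℝ} {s : ℝ}

lemma integral_weightedDirection (hW : Measurable W) {φ : (Fin d → ℝ) → ℝ} (hφ : Measurable φ) :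
    ∫ y, φ y ∂weightedDirection m W s = ∫ x, vnorm (W x) ^ s * φ (direction (W x)) ∂m := by
  have hdW : Measurable fun x => direction (W x) := measurable_direction.comp hW
  have hwW : Measurable fun x => ENNReal.ofReal (vnorm (W x) ^ s) :=
    ((measurable_vnorm.comp hW).pow_const s).ennreal_ofReal
  rw [weightedDirection, integral_map hdW.aemeasurable
    hφ.aestronglyMeasurable, integral_withDensity_eq_integral_toReal_smul hwW (ae_of_all _ fun _ => by simp)]
  refine integral_congr_ae (ae_of_all _ fun x => ?_)
  simp only [smul_eq_mul]
  rw [ENNReal.toReal_ofReal (Real.rpow_nonneg (vnorm_nonneg _) s)]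

lemma isFiniteMeasure_weightedDirection (hint : Integrable (fun x => vnorm (W x) ^ s) m) :
    IsFiniteMeasure (weightedDirection m W s) := by
  have := isFiniteMeasure_withDensity_ofReal hint.2
  unfold weightedDirection
  infer_instance

lemma ae_weightedDirection_mem (hs : 0 < s) (hW : Measurable W) (h0 : ∀ᵐ x ∂m, ∀ i, 0 ≤ W x i) :
    ∀ᵐ y ∂weightedDirection m W s, y ∈ stdSimplex ℝ (Fin d) := by
  have hdW : Measurable fun x => direction (W x) := measurable_direction.comp hW
  have hwW : Measurable fun x => ENNReal.ofReal (vnorm (W x) ^ s) :=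
    ((measurable_vnorm.comp hW).pow_const s).ennreal_ofReal
  rw [weightedDirection, ae_map_iff (p := (· ∈ stdSimplex ℝ (Fin d))) hdW.aemeasurable
    isClosed_simplex.measurableSet, ae_withDensity_iff hwW]
  filter_upwards [h0] with x hx hne
  refine direction_mem_stdSimplex hx fun h => hne ?_
  simp [h, vnorm_zero, Real.zero_rpow hs.ne']

lemma integrable_of_continuous_of_ae_mem_simplex {m : Measure (Fin d → ℝ)} [IsFiniteMeasure m]
    (hm : ∀ᵐ y ∂m, y ∈ stdSimplex ℝ (Fin d)) {f : (Fin d → ℝ) → ℝ} (hf : Continuous f) :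
    Integrable f m := by
  obtain ⟨C, hC⟩ := (isCompact_stdSimplex ℝ (Fin d)).exists_bound_of_continuousOn hf.continuousOn
  refine Integrable.mono' (integrable_const C) hf.measurable.aestronglyMeasurable ?_
  filter_upwards [hm] with y hy using hC y hy

/-- The direction is discontinuous only at `0`, where the factor `|w| ^ s` kills the bounded `φ`. -/
lemma continuous_vnorm_rpow_mul_direction (hs : 0 < s) {φ : (Fin d → ℝ) → ℝ} (hφ : Continuous φ)
    {C : ℝ} (hC : ∀ x, |φ x| ≤ C) :
    Continuous fun w : Fin d → ℝ => vnorm w ^ s * φ (direction w) := by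
  have hv : Continuous fun w : Fin d → ℝ => vnorm w ^ s :=
    continuous_vnorm.rpow_const fun _ => Or.inr hs.le
  refine continuous_iff_continuousAt.2 fun w => ?_
  by_cases hw : w = 0
  · subst hw
    have h0 : Tendsto (fun w : Fin d → ℝ => vnorm w ^ s) (𝓝 0) (𝓝 0) := by
      have := hv.tendsto (0 : Fin d → ℝ)
      rwa [vnorm_zero, Real.zero_rpow hs.ne'] at this
    rw [ContinuousAt, vnorm_zero, Real.zero_rpow hs.ne', zero_mul]
    refine squeeze_zero_norm (fun w => ?_) (by simpa using h0.mul_const C)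
    rw [norm_mul, Real.norm_of_nonneg (Real.rpow_nonneg (vnorm_nonneg _) s)]
    exact mul_le_mul_of_nonneg_left (hC _) (Real.rpow_nonneg (vnorm_nonneg _) s)
  · exact hv.continuousAt.mul (hφ.continuousAt.comp (continuousAt_direction hw))

variable {μ : Measure (Matrix (Fin d) (Fin d) ℝ)} [IsProbabilityMeasure μ]

lemma norm_vnorm_rpow_mul_le (hd : 1 ≤ d) (hs : 0 < s) {φ : (Fin d → ℝ) → ℝ} {C : ℝ}
    (hC : ∀ x, |φ x| ≤ C) (g : Matrix (Fin d) (Fin d) ℝ) {x : Fin d → ℝ} {r : ℝ}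
    (hx : vnorm x ≤ r) :
    ‖vnorm (gᵀ *ᵥ x) ^ s * φ (direction (gᵀ *ᵥ x))‖ ≤ (d * r) ^ s * C * opNorm g ^ s := by
  have hr : 0 ≤ r := (vnorm_nonneg x).trans hx
  have hC0 : 0 ≤ C := (abs_nonneg _).trans (hC 0)
  have hb : vnorm (gᵀ *ᵥ x) ≤ d * r * opNorm g := by
    refine (vnorm_transpose_mulVec_le hd g x).trans ?_
    have := mul_le_mul_of_nonneg_left hx
      (mul_nonneg (Nat.cast_nonneg (α := ℝ) d) (opNorm_nonneg g))
    linarith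
  rw [norm_mul, Real.norm_of_nonneg (Real.rpow_nonneg (vnorm_nonneg _) s), mul_right_comm,
    ← Real.mul_rpow (by positivity) (opNorm_nonneg g)]
  exact mul_le_mul (Real.rpow_le_rpow (vnorm_nonneg _) hb hs.le) (hC _) (norm_nonneg _)
    (Real.rpow_nonneg ((vnorm_nonneg _).trans hb) s)

omit [IsProbabilityMeasure μ] in
lemma continuous_conjTransfer (hd : 1 ≤ d) (hs : 0 < s) (hsI : s ∈ momentSet μ)
    {φ : (Fin d → ℝ) → ℝ} (hφ : Continuous φ) {C : ℝ} (hC : ∀ x, |φ x| ≤ C) :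
    Continuous (conjTransfer μ s φ) := by
  have hcont := (continuous_vnorm_rpow_mul_direction hs hφ hC).comp
    (continuous_transpose_mulVec (d := d))
  refine continuous_iff_continuousAt.2 fun x₀ => ?_
  refine continuousAt_of_dominated
    (bound := fun g => (d * (vnorm x₀ + 1)) ^ s * C * opNorm g ^ s) ?_ ?_ ?_ ?_
  · exact Eventually.of_forall fun x =>
      (hcont.comp (Continuous.prodMk_left x)).measurable.aestronglyMeasurable
  · filter_upwards [continuous_vnorm.continuousAt.eventually_le_const (lt_add_one (vnorm x₀))]
      with x hx
    exact ae_of_all _ fun g => norm_vnorm_rpow_mul_le hd hs hC g hx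
  · exact hsI.2.const_mul _
  · exact ae_of_all _ fun g => (hcont.comp (Continuous.prodMk_right g)).continuousAt

lemma mem_momentSet_convPow (hd : 1 ≤ d) (hsI : s ∈ momentSet μ) (n : ℕ) :
    s ∈ momentSet (convPow μ n) := by
  refine ⟨hsI.1, ((measurable_opNorm hd).pow_const s).aestronglyMeasurable, ?_⟩
  rw [hasFiniteIntegral_iff_ofReal (ae_of_all _ fun g => Real.rpow_nonneg (opNorm_nonneg g) s)]
  simp_rw [← ENNReal.ofReal_rpow_of_nonneg (opNorm_nonneg _) hsI.1]
  exact moment_lt_top hd hsI.1 (moment_one_lt_top hsI) n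

/-- The cocycle identity: `(g h)ᵀ = hᵀ gᵀ`, and `|hᵀ w| = |w| |hᵀ (w / |w|)|`. -/
lemma conjTransfer_convPow_succ (hd : 1 ≤ d) (hs : 0 < s) (hsI : s ∈ momentSet μ)
    {φ : (Fin d → ℝ) → ℝ} (hφ : Continuous φ) {C : ℝ} (hC : ∀ x, |φ x| ≤ C) (n : ℕ)
    (x : Fin d → ℝ) :
    conjTransfer (convPow μ (n + 1)) s φ x =
      conjTransfer (convPow μ n) s (conjTransfer μ s φ) x := by
  have hcont := (continuous_vnorm_rpow_mul_direction hs hφ hC).comp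
    (continuous_transpose_mulVec (d := d))
  have hgm : AEStronglyMeasurable (fun g : Matrix (Fin d) (Fin d) ℝ =>
      vnorm (gᵀ *ᵥ x) ^ s * φ (direction (gᵀ *ᵥ x))) (convPow μ n ∗ₘ μ) :=
    (hcont.comp (Continuous.prodMk_left x)).measurable.aestronglyMeasurable
  rw [conjTransfer, convPow, Measure.mconv, integral_map measurable_mul.aemeasurable hgm,
    integral_prod]
  · rw [conjTransfer]
    refine integral_congr_ae (ae_of_all _ fun g => ?_)
    simp only [conjTransfer]
    rw [← integral_const_mul]
    refine integral_congr_ae (ae_of_all _ fun h => ?_)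
    simp only [Matrix.transpose_mul, ← Matrix.mulVec_mulVec]
    set w := gᵀ *ᵥ x
    by_cases hw : w = 0
    · simp [hw, vnorm_zero, Real.zero_rpow hs.ne']
    · have hwp := vnorm_pos hw
      have hh : hᵀ *ᵥ w = vnorm w • (hᵀ *ᵥ direction w) := by
        rw [← Matrix.mulVec_smul, vnorm_smul_direction]
      rw [hh, vnorm_smul, direction_smul hwp, abs_of_pos hwp,
        Real.mul_rpow hwp.le (vnorm_nonneg _), mul_assoc]
  · have hI := ((mem_momentSet_convPow hd hsI n).2.mul_prod hsI.2).const_mul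
      ((d * vnorm x) ^ s * C)
    have hC0 : 0 ≤ C := (abs_nonneg _).trans (hC 0)
    refine Integrable.mono' hI ?_ (ae_of_all _ fun p => ?_)
    · exact ((hcont.comp (Continuous.prodMk_left x)).measurable.comp
        measurable_mul).aestronglyMeasurable
    · refine (norm_vnorm_rpow_mul_le hd hs hC (p.1 * p.2) le_rfl).trans
        (mul_le_mul_of_nonneg_left ?_ (mul_nonneg
          (Real.rpow_nonneg (mul_nonneg (Nat.cast_nonneg d) (vnorm_nonneg x)) s) hC0))
      rw [← Real.mul_rpow (opNorm_nonneg _) (opNorm_nonneg _)]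
      exact Real.rpow_le_rpow (opNorm_nonneg _) (opNorm_mul_le hd _ _) hs.le

/-- An eigenmeasure tested against bounded continuous functions is one tested against bounded
measurable functions. -/
lemma isConjEigenmeasure_of_continuous (hd : 1 ≤ d) (hs : 0 < s) (hsI : s ∈ momentSet μ)
    {ν : Measure (Fin d → ℝ)} [IsProbabilityMeasure ν] {k : ℝ} (hk : 0 ≤ k)
    (hcar : ∀ᵐ y ∂ν, y ∈ stdSimplex ℝ (Fin d))
    (heig : ∀ φ : BoundedContinuousFunction (Fin d → ℝ) ℝ,
      ∫ x, conjTransfer μ s φ x ∂ν = k * ∫ x, φ x ∂ν) :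
    IsConjEigenmeasure μ s k ν := by
  set W : (Fin d → ℝ) × Matrix (Fin d) (Fin d) ℝ → Fin d → ℝ := fun p => p.2ᵀ *ᵥ p.1 with hW
  have hWm : Measurable W :=
    (continuous_transpose_mulVec.comp continuous_swap).measurable
  have hbound : ∀ φ : (Fin d → ℝ) → ℝ, Measurable φ → (∃ C : ℝ, ∀ x, |φ x| ≤ C) →
      Integrable (fun p => vnorm (W p) ^ s * φ (direction (W p))) (ν.prod μ) := by
    rintro φ hφ ⟨C, hC⟩
    refine Integrable.mono' ((hsI.2.const_mul ((d * 1) ^ s * C)).comp_snd ν)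
      (((measurable_vnorm.comp hWm).pow_const s).mul
        (hφ.comp (measurable_direction.comp hWm))).aestronglyMeasurable ?_
    have h1 := Measure.quasiMeasurePreserving_fst (μ := ν) (ν := μ) |>.ae hcar
    filter_upwards [h1] with p hp
    exact norm_vnorm_rpow_mul_le hd hs hC p.2 (vnorm_of_mem_stdSimplex hp).le
  have hformula : ∀ φ : (Fin d → ℝ) → ℝ, Measurable φ → (∃ C : ℝ, ∀ x, |φ x| ≤ C) →
      ∫ y, φ y ∂weightedDirection (ν.prod μ) W s = ∫ x, conjTransfer μ s φ x ∂ν := by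
    intro φ hφ hC
    rw [integral_weightedDirection hWm hφ, integral_prod _ (hbound φ hφ hC)]
    rfl
  have hfin : IsFiniteMeasure (weightedDirection (ν.prod μ) W s) := by
    refine isFiniteMeasure_weightedDirection ?_
    simpa using hbound (fun _ => 1) measurable_const ⟨1, by simp⟩
  -- Both sides are finite measures, hence determined by bounded continuous functions; as an
  -- equality of measures the equation extends to measurable ones.
  have heq : weightedDirection (ν.prod μ) W s = k.toNNReal • ν := by
    refine ext_of_forall_integral_eq_of_IsFiniteMeasure fun φ => ?_
    rw [hformula φ φ.continuous.measurable ⟨‖φ‖, φ.norm_coe_le_norm⟩, heig φ,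
      integral_smul_nnreal_measure, NNReal.smul_def, Real.coe_toNNReal k hk, smul_eq_mul]
  refine ⟨inferInstance, hcar, fun φ hφ hC => ?_⟩
  rw [← hformula φ hφ hC, heq, integral_smul_nnreal_measure, NNReal.smul_def,
    Real.coe_toNNReal k hk, smul_eq_mul]

end

end

/-! ### Existence of the eigenmeasure. -/

section

variable {d : ℕ} {s : ℝ} {μ : Measure (Matrix (Fin d) (Fin d) ℝ)} [IsProbabilityMeasure μ]

/-- The barycentre of the simplex. -/
noncomputable def barycenter (d : ℕ) : Fin d → ℝ := fun _ => (d : ℝ)⁻¹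

lemma barycenter_mem (hd : 1 ≤ d) : barycenter d ∈ stdSimplex ℝ (Fin d) := by
  have : (d : ℝ) ≠ 0 := by exact_mod_cast (by omega : d ≠ 0)
  exact ⟨fun _ => by unfold barycenter; positivity, by simp [barycenter, this]⟩

lemma opNorm_le_vnorm_transpose_mulVec (hd : 1 ≤ d) {g : Matrix (Fin d) (Fin d) ℝ}
    (hg : ∀ i j, 0 ≤ g i j) : (d : ℝ)⁻¹ * opNorm g ≤ vnorm (gᵀ *ᵥ barycenter d) := by
  have h0 := mulVec_nonneg (g := gᵀ) (fun i j => hg j i) (barycenter_mem hd).1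
  rw [vnorm_of_nonneg h0]
  refine (mul_le_mul_of_nonneg_left (opNorm_le_entrySum hd g) (by positivity)).trans_eq ?_
  simp only [entrySum, colSum, Matrix.mulVec, dotProduct, barycenter, Matrix.transpose_apply,
    ← Finset.sum_mul, abs_of_nonneg (hg _ _)]
  rw [mul_comm]

/-- The weight of the barycentre under the `n`-th power of the conjugate transfer operator. -/
noncomputable def baryMass (μ : Measure (Matrix (Fin d) (Fin d) ℝ)) (s : ℝ) (n : ℕ) : ℝ :=
  conjTransfer (convPow μ n) s (fun _ => 1) (barycenter d)

omit [IsProbabilityMeasure μ] in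
lemma integrable_vnorm_transpose_mulVec (hd : 1 ≤ d) (hs : 0 < s) (hsI : s ∈ momentSet μ)
    (x : Fin d → ℝ) : Integrable (fun g => vnorm (gᵀ *ᵥ x) ^ s) μ := by
  refine Integrable.mono' (hsI.2.const_mul ((d * vnorm x) ^ s * 1)) ?_ (ae_of_all _ fun g => ?_)
  · exact ((measurable_vnorm.comp (continuous_transpose_mulVec.comp
      (Continuous.prodMk_left x)).measurable).pow_const s).aestronglyMeasurable
  · simpa using norm_vnorm_rpow_mul_le hd hs (φ := fun _ => 1) (C := 1) (by simp) g le_rfl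

omit [IsProbabilityMeasure μ] in
lemma toReal_moment (hd : 1 ≤ d) (hs : 0 ≤ s) (n : ℕ) :
    (moment μ s n).toReal = ∫ g, opNorm g ^ s ∂convPow μ n := by
  rw [integral_eq_lintegral_of_nonneg_ae
    (ae_of_all _ fun ω => Real.rpow_nonneg (opNorm_nonneg _) s)
    ((measurable_opNorm hd).pow_const s).aestronglyMeasurable, moment]
  simp_rw [ENNReal.ofReal_rpow_of_nonneg (opNorm_nonneg _) hs]

/-- Together with `baryMass_le`, this makes `baryMass` comparable to the moment, up to factors `d ^
(±s)`. The barycentre serves as starting point because all its coordinates are positive. -/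
lemma le_baryMass (hd : 1 ≤ d) (hs : 0 < s) (hμ : ∀ᵐ g ∂μ, ∀ i j, 0 ≤ g i j)
    (hsI : s ∈ momentSet μ) (n : ℕ) :
    ((d : ℝ)⁻¹) ^ s * (moment μ s n).toReal ≤ baryMass μ s n := by
  have hI := mem_momentSet_convPow hd hsI n
  rw [toReal_moment hd hs.le, ← integral_const_mul, baryMass, conjTransfer]
  simp only [mul_one]
  refine integral_mono_ae (hI.2.const_mul _) (integrable_vnorm_transpose_mulVec hd hs hI _) ?_
  filter_upwards [ae_convPow_nonneg μ hμ n] with g hg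
  rw [← Real.mul_rpow (by positivity) (opNorm_nonneg g)]
  exact Real.rpow_le_rpow (mul_nonneg (by positivity) (opNorm_nonneg g))
    (opNorm_le_vnorm_transpose_mulVec hd hg) hs.le

lemma abs_conjTransfer_le {m : Measure (Matrix (Fin d) (Fin d) ℝ)} [IsProbabilityMeasure m]
    (hd : 1 ≤ d) (hs : 0 < s) (hsI : s ∈ momentSet m) {φ : (Fin d → ℝ) → ℝ} {C : ℝ}
    (hC : ∀ x, |φ x| ≤ C) (x : Fin d → ℝ) :
    |conjTransfer m s φ x| ≤ C * conjTransfer m s (fun _ => 1) x := by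
  unfold conjTransfer
  rw [← integral_const_mul, ← Real.norm_eq_abs]
  simp only [mul_one]
  refine norm_integral_le_of_norm_le
    ((integrable_vnorm_transpose_mulVec hd hs hsI x).const_mul C) (ae_of_all _ fun g => ?_)
  rw [norm_mul, Real.norm_of_nonneg (Real.rpow_nonneg (vnorm_nonneg _) s), mul_comm]
  exact mul_le_mul_of_nonneg_right (hC _) (Real.rpow_nonneg (vnorm_nonneg _) s)

lemma baryMass_le (hd : 1 ≤ d) (hs : 0 < s) (hsI : s ∈ momentSet μ) (n : ℕ) :
    baryMass μ s n ≤ (d : ℝ) ^ s * (moment μ s n).toReal := by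
  have hI := mem_momentSet_convPow hd hsI n
  rw [toReal_moment hd hs.le, ← integral_const_mul, baryMass, conjTransfer]
  simp only [mul_one]
  refine integral_mono (integrable_vnorm_transpose_mulVec hd hs hI _) (hI.2.const_mul _)
    fun g => ?_
  have := norm_vnorm_rpow_mul_le hd hs (φ := fun _ => 1) (C := 1) (by simp) g
    (vnorm_of_mem_stdSimplex (barycenter_mem hd)).le
  simp only [mul_one] at this
  exact (le_abs_self _).trans this

/-- Krylov–Bogoliubov: the normalised sums of `k^{-n} δ_{x₀} (P_s^*)^n` are invariant up to a
telescoping boundary term, and live on a compact simplex. -/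
theorem exists_isConjEigenmeasure (hd : 1 ≤ d) (hs : 0 < s) (hμ : ∀ᵐ g ∂μ, ∀ i j, 0 ≤ g i j)
    (hsI : s ∈ momentSet μ) {k : ℝ} (hk : 0 < k)
    (hlim : Tendsto (fun n : ℕ => (moment μ s n).toReal ^ (1 / (n : ℝ))) atTop (𝓝 k))
    (hle : ∀ n, k ^ n ≤ (moment μ s n).toReal) :
    ∃ ν : Measure (Fin d → ℝ), IsConjEigenmeasure μ s k ν := by
  have hd0 : (0 : ℝ) < d := by exact_mod_cast hd
  set x₀ := barycenter d with hx₀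
  set c : ℕ → ℝ := fun n => (k ^ n)⁻¹ * baryMass μ s n with hc
  set Z : ℕ → ℝ := fun N => ∑ n ∈ Finset.range N, c n with hZ
  set δ : ℝ := ((d : ℝ)⁻¹) ^ s with hδdef
  have hδ : 0 < δ := by positivity
  -- Fekete's bound `k ^ n ≤ E‖Π_n‖ ^ s` keeps the masses away from `0`, so their sums diverge.
  have hcδ : ∀ n, δ ≤ c n := fun n => by
    have h1 := (mul_le_mul_of_nonneg_left (hle n) hδ.le).trans (le_baryMass hd hs hμ hsI n)
    rw [hc]
    dsimp only
    rw [le_inv_mul_iff₀ (by positivity), mul_comm]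
    exact h1
  have hsub : ∀ ρ : ℝ, 1 < ρ → ∀ᶠ n in atTop, c n ≤ (d : ℝ) ^ s * ρ ^ n := by
    intro ρ hρ
    filter_upwards [hlim.eventually_lt_const (show k < ρ * k by nlinarith), eventually_ge_atTop 1]
      with n hn hn1
    have h1 : (moment μ s n).toReal ≤ (ρ * k) ^ n := by
      have := pow_le_pow_left₀ (by positivity) hn.le n
      rwa [one_div, Real.rpow_inv_natCast_pow ENNReal.toReal_nonneg (by omega)] at this
    rw [hc]
    dsimp only
    rw [inv_mul_le_iff₀ (by positivity)]
    calc baryMass μ s n ≤ (d : ℝ) ^ s * (moment μ s n).toReal := baryMass_le hd hs hsI n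
      _ ≤ (d : ℝ) ^ s * (ρ * k) ^ n := mul_le_mul_of_nonneg_left h1 (by positivity)
      _ = k ^ n * ((d : ℝ) ^ s * ρ ^ n) := by rw [mul_pow]; ring
  -- Lengths of averaging along which the last mass is negligible against the total.
  obtain ⟨N, hNmono, hN⟩ := extraction_forall_of_frequently
    (P := fun j N => c N < 1 / ((j : ℝ) + 1) * Z N)
    fun j => frequently_lt_mul_sum_of_subexponential hδ hcδ hsub (by positivity)
  have hZge : ∀ n, n * δ ≤ Z n := fun n => by
    have := Finset.card_nsmul_le_sum (Finset.range n) c δ fun i _ => hcδ i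
    simpa using this
  have hNpos : ∀ j, 0 < Z (N j) := fun j =>
    pos_of_mul_pos_right ((hδ.trans_le (hcδ (N j))).trans (hN j)) (by positivity)
  have hcZ : Tendsto (fun j => c (N j) / Z (N j)) atTop (𝓝 0) := by
    refine squeeze_zero (fun j => div_nonneg (hδ.le.trans (hcδ _)) (hNpos j).le)
      (fun j => ?_) tendsto_one_div_add_atTop_nhds_zero_nat
    rw [div_le_iff₀ (hNpos j)]; exact (hN j).le
  have hZinf : Tendsto (fun j => Z (N j)) atTop atTop := by
    refine (tendsto_atTop_mono hZge ?_).comp hNmono.tendsto_atTop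
    exact tendsto_natCast_atTop_atTop.atTop_mul_const hδ
  -- the averaged measures
  set W : Matrix (Fin d) (Fin d) ℝ → Fin d → ℝ := fun g => gᵀ *ᵥ x₀ with hW
  have hWm : Measurable W :=
    (continuous_transpose_mulVec.comp (Continuous.prodMk_left x₀)).measurable
  set θ : ℕ → Measure (Fin d → ℝ) := fun n => weightedDirection (convPow μ n) W s with hθ
  have hθfin : ∀ n, IsFiniteMeasure (θ n) := fun n => isFiniteMeasure_weightedDirection
    (integrable_vnorm_transpose_mulVec hd hs (mem_momentSet_convPow hd hsI n) x₀)
  have hθmem : ∀ n, ∀ᵐ y ∂θ n, y ∈ stdSimplex ℝ (Fin d) := fun n => by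
    refine ae_weightedDirection_mem hs hWm ?_
    filter_upwards [ae_convPow_nonneg μ hμ n] with g hg
    exact mulVec_nonneg (fun i j => hg j i) (barycenter_mem hd).1
  have hθint : ∀ n, ∀ φ : (Fin d → ℝ) → ℝ, Measurable φ →
      ∫ y, φ y ∂θ n = conjTransfer (convPow μ n) s φ x₀ := fun n φ hφ =>
    integral_weightedDirection hWm hφ
  set m : ℕ → Measure (Fin d → ℝ) := fun j =>
    (Z (N j)).toNNReal⁻¹ • ∑ n ∈ Finset.range (N j), ((k ^ n)⁻¹).toNNReal • θ n with hm
  have hmfin : ∀ j, IsFiniteMeasure (m j) := fun j => by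
    rw [hm]; infer_instance
  have hmmem : ∀ j, ∀ᵐ y ∂m j, y ∈ stdSimplex ℝ (Fin d) := fun j => by
    refine Measure.ae_smul_measure ?_ _
    rw [ae_iff, Measure.finsetSum_apply]
    refine Finset.sum_eq_zero fun n _ => ?_
    exact Measure.ae_smul_measure (hθmem n) _
  have hmint : ∀ j, ∀ φ : (Fin d → ℝ) → ℝ, Continuous φ →
      ∫ y, φ y ∂m j = (Z (N j))⁻¹ *
        ∑ n ∈ Finset.range (N j), (k ^ n)⁻¹ * conjTransfer (convPow μ n) s φ x₀ := by
    intro j φ hφ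
    rw [hm, integral_smul_nnreal_measure, integral_finsetSum_measure fun n _ =>
      (integrable_of_continuous_of_ae_mem_simplex (hθmem n) hφ).smul_measure_nnreal,
      NNReal.smul_def, NNReal.coe_inv, Real.coe_toNNReal _ (hNpos j).le, smul_eq_mul]
    congr 1
    refine Finset.sum_congr rfl fun n _ => ?_
    rw [integral_smul_nnreal_measure, NNReal.smul_def, Real.coe_toNNReal _ (by positivity),
      smul_eq_mul, hθint n φ hφ.measurable]
  have hmprob : ∀ j, IsProbabilityMeasure (m j) := fun j => by
    have h := hmint j (fun _ => 1) continuous_const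
    rw [integral_const, smul_eq_mul, mul_one] at h
    have h2 : (m j).real Set.univ = 1 := h.trans (inv_mul_cancel₀ (hNpos j).ne')
    exact ⟨by rwa [← ENNReal.toReal_eq_one_iff]⟩
  -- the defect of invariance
  have hdefect : ∀ φ : BoundedContinuousFunction (Fin d → ℝ) ℝ, Tendsto
      (fun j => ∫ y, conjTransfer μ s φ y ∂m j - k * ∫ y, φ y ∂m j) atTop (𝓝 0) := by
    intro φ
    have hC : ∀ x, |φ x| ≤ ‖φ‖ := φ.norm_coe_le_norm
    have hTc := continuous_conjTransfer hd hs hsI φ.continuous hC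
    set ℓ : ℕ → ℝ := fun n => (k ^ n)⁻¹ * conjTransfer (convPow μ n) s φ x₀ with hℓ
    have hℓle : ∀ n, |ℓ n| ≤ ‖φ‖ * c n := fun n => by
      rw [hℓ, hc]
      dsimp only
      rw [abs_mul, abs_of_pos (by positivity), mul_left_comm]
      exact mul_le_mul_of_nonneg_left
        (abs_conjTransfer_le hd hs (mem_momentSet_convPow hd hsI n) hC x₀) (by positivity)
    -- Applying the operator shifts the index by one, so the sum telescopes to its two ends; these
    -- are bounded by `‖φ‖ * c (N j)` and `|ℓ 0|`.
    have hform : ∀ j, ∫ y, conjTransfer μ s φ y ∂m j - k * ∫ y, φ y ∂m j =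
        k * ((Z (N j))⁻¹ * (ℓ (N j) - ℓ 0)) := by
      intro j
      have hstep : ∀ n, (k ^ n)⁻¹ * conjTransfer (convPow μ n) s (conjTransfer μ s φ) x₀ =
          k * ℓ (n + 1) := fun n => by
        rw [hℓ]
        dsimp only
        rw [conjTransfer_convPow_succ hd hs hsI φ.continuous hC, pow_succ]
        field_simp
      rw [hmint j _ hTc, hmint j _ φ.continuous, ← Finset.sum_range_sub ℓ,
        Finset.sum_congr rfl fun n _ => hstep n, ← Finset.mul_sum, Finset.sum_sub_distrib]
      ring
    simp_rw [hform]
    have hlim0 : Tendsto (fun j => k * (‖φ‖ * (c (N j) / Z (N j)) + |ℓ 0| / Z (N j)))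
        atTop (𝓝 0) := by
      simpa using ((hcZ.const_mul ‖φ‖).add (hZinf.const_div_atTop |ℓ 0|)).const_mul k
    refine squeeze_zero_norm (fun j => ?_) hlim0
    rw [norm_mul, norm_mul, Real.norm_of_nonneg hk.le,
      Real.norm_of_nonneg (inv_nonneg.2 (hNpos j).le)]
    refine mul_le_mul_of_nonneg_left ?_ hk.le
    rw [← mul_div_assoc, ← add_div, inv_mul_eq_div]
    refine div_le_div_of_nonneg_right ?_ (hNpos j).le
    exact (norm_sub_le _ _).trans (add_le_add (hℓle _) le_rfl)
  -- a cluster point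
  have hKm : MeasurableSet (stdSimplex ℝ (Fin d)) := isClosed_simplex.measurableSet
  -- The measures are moved to the simplex as a subtype, whose probability measures form a compact
  -- space; a free ultrafilter then selects a limit.
  have hcomap : ∀ j, ∀ φ : (Fin d → ℝ) → ℝ,
      ∫ y : stdSimplex ℝ (Fin d), φ y.1 ∂(m j).comap Subtype.val = ∫ y, φ y ∂m j := by
    intro j φ
    rw [integral_subtype_comap hKm, Measure.restrict_eq_self_of_ae_mem (hmmem j)]
  have hprob : ∀ j, IsProbabilityMeasure
      ((m j).comap (Subtype.val : stdSimplex ℝ (Fin d) → Fin d → ℝ)) := fun j => by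
    refine ⟨?_⟩
    rw [(MeasurableEmbedding.subtype_coe hKm).comap_apply, Set.image_univ, Subtype.range_coe,
      ← prob_compl_eq_zero_iff hKm]
    exact hmmem j
  set pm : ℕ → ProbabilityMeasure (stdSimplex ℝ (Fin d)) := fun j => ⟨_, hprob j⟩ with hpm
  have : CompactSpace (stdSimplex ℝ (Fin d)) :=
    isCompact_iff_compactSpace.1 (isCompact_stdSimplex ℝ (Fin d))
  set U : Ultrafilter ℕ := hyperfilter ℕ with hU
  obtain ⟨p, -, hp⟩ := isCompact_univ.ultrafilter_le_nhds (U.map pm) (by simp)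
  have hUat : (U : Filter ℕ) ≤ atTop := Nat.hyperfilter_le_atTop
  have hpt : Tendsto pm U (𝓝 p) := hp
  rw [ProbabilityMeasure.tendsto_iff_forall_integral_tendsto] at hpt
  have hconv : ∀ φ : (Fin d → ℝ) → ℝ, Continuous φ → Tendsto (fun j => ∫ y, φ y ∂m j) U
      (𝓝 (∫ y, φ y ∂(p : Measure (stdSimplex ℝ (Fin d))).map Subtype.val)) := by
    intro φ hφ
    have h := hpt (BoundedContinuousFunction.mkOfCompact
      ⟨fun y : stdSimplex ℝ (Fin d) => φ y.1, hφ.comp continuous_subtype_val⟩)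
    rw [integral_map measurable_subtype_coe.aemeasurable hφ.measurable.aestronglyMeasurable]
    refine h.congr fun j => ?_
    exact hcomap j φ
  have hνprob : IsProbabilityMeasure
      ((p : Measure (stdSimplex ℝ (Fin d))).map Subtype.val) :=
    Measure.isProbabilityMeasure_map measurable_subtype_coe.aemeasurable
  refine ⟨(p : Measure (stdSimplex ℝ (Fin d))).map Subtype.val,
    isConjEigenmeasure_of_continuous hd hs hsI hk.le ?_ fun φ => ?_⟩
  · rw [ae_map_iff (p := (· ∈ stdSimplex ℝ (Fin d))) measurable_subtype_coe.aemeasurable hKm]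
    exact ae_of_all _ fun y => y.2
  · have h1 := hconv _ (continuous_conjTransfer hd hs hsI φ.continuous φ.norm_coe_le_norm)
    have h2 := (hconv _ φ.continuous).const_mul k
    exact sub_eq_zero.1 (tendsto_nhds_unique (h1.sub h2) ((hdefect φ).mono_left hUat))

end

/-! ### Moment recursion for the forward process. -/

section

section

variable {Ω : Type*} [MeasurableSpace Ω] {P : Measure Ω} [IsProbabilityMeasure P] {d : ℕ} {s k : ℝ}
  {μ : Measure (Matrix (Fin d) (Fin d) ℝ)} {ν : Measure (Fin d → ℝ)}

omit [MeasurableSpace Ω] in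
lemma prodMat_nonneg {M : ℕ → Ω → Matrix (Fin d) (Fin d) ℝ}
    (hM0 : ∀ n ω i j, 0 ≤ M n ω i j) (n : ℕ) (ω : Ω) (i j : Fin d) : 0 ≤ prodMat M n ω i j := by
  induction n generalizing i j with
  | zero => rw [prodMat, Matrix.one_apply]; split_ifs <;> norm_num
  | succ n ih => exact mul_nonneg_entries ih (hM0 n ω) i j

omit [MeasurableSpace Ω] in
lemma perp_nonneg {M : ℕ → Ω → Matrix (Fin d) (Fin d) ℝ} {Q : ℕ → Ω → Fin d → ℝ}
    (hM0 : ∀ n ω i j, 0 ≤ M n ω i j) (hQ0 : ∀ n ω i, 0 ≤ Q n ω i) (n : ℕ) (ω : Ω) (i : Fin d) :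
    0 ≤ perp M Q n ω i := by
  rw [perp, Finset.sum_apply]
  exact Finset.sum_nonneg fun k _ => mulVec_nonneg (prodMat_nonneg hM0 k ω) (hQ0 k ω) i

lemma lintegral_homEigenfun_mulVec_of_indepFun [IsProbabilityMeasure μ] (hd : 1 ≤ d) (hs : 0 < s)
    (hμ : ∀ᵐ g ∂μ, ∀ i j, 0 ≤ g i j) (hsI : s ∈ momentSet μ) (hν : IsConjEigenmeasure μ s k ν)
    {A : Ω → Matrix (Fin d) (Fin d) ℝ} {X : Ω → Fin d → ℝ} (hA : Measurable A) (hX : Measurable X)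
    (hlaw : P.map A = μ) (hind : IndepFun A X P) :
    ∫⁻ ω, homEigenfun s ν (A ω *ᵥ X ω) ∂P = ENNReal.ofReal k * ∫⁻ ω, homEigenfun s ν (X ω) ∂P := by
  have := hν.prob
  have hm := measurable_homEigenfun s ν
  have hF : Measurable fun p : Matrix (Fin d) (Fin d) ℝ × (Fin d → ℝ) =>
      homEigenfun s ν (p.1 *ᵥ p.2) := hm.comp continuous_mulVec.measurable
  have := Measure.isProbabilityMeasure_map (μ := P) hX.aemeasurable
  rw [← lintegral_map hF (hA.prodMk hX),
    (indepFun_iff_map_prod_eq_prod_map_map hA.aemeasurable hX.aemeasurable).1 hind, hlaw,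
    lintegral_prod_symm _ hF.aemeasurable]
  simp_rw [lintegral_homEigenfun_mulVec hd hs hμ hsI hν]
  rw [lintegral_const_mul _ hm, lintegral_map hm hX]

omit [IsProbabilityMeasure P] in
-- `E R(X)` is the integral of `⟨X, y⟩₊ ^ s` over `P.prod ν`. The exponent `1 / max s 1` covers
-- Minkowski's inequality for `s ≥ 1` and subadditivity of `x ^ s` for `s ≤ 1`.
lemma lintegral_homEigenfun_add_rpow_le [IsProbabilityMeasure ν] (hs : 0 < s)
    {X Y : Ω → Fin d → ℝ} (hX : Measurable X) (hY : Measurable Y) :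
    (∫⁻ ω, homEigenfun s ν (X ω + Y ω) ∂P) ^ (1 / max s 1) ≤
      (∫⁻ ω, homEigenfun s ν (X ω) ∂P) ^ (1 / max s 1) +
        (∫⁻ ω, homEigenfun s ν (Y ω) ∂P) ^ (1 / max s 1) := by
  have hF : ∀ {X : Ω → Fin d → ℝ}, Measurable X →
      Measurable fun p : Ω × (Fin d → ℝ) => ENNReal.ofReal (X p.1 ⬝ᵥ p.2) := fun {X} hX => by
    have : Continuous fun p : (Fin d → ℝ) × (Fin d → ℝ) => p.1 ⬝ᵥ p.2 := by fun_prop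
    exact (this.measurable.comp
      ((hX.comp measurable_fst).prodMk measurable_snd)).ennreal_ofReal
  have hprod : ∀ {X : Ω → Fin d → ℝ}, Measurable X → ∫⁻ ω, homEigenfun s ν (X ω) ∂P =
      ∫⁻ p, ENNReal.ofReal (X p.1 ⬝ᵥ p.2) ^ s ∂P.prod ν := fun {X} hX => by
    rw [lintegral_prod _ ((hF hX).pow_const s).aemeasurable]; rfl
  have hle : ∫⁻ ω, homEigenfun s ν (X ω + Y ω) ∂P ≤ ∫⁻ p, ((fun p : Ω × (Fin d → ℝ) =>
      ENNReal.ofReal (X p.1 ⬝ᵥ p.2)) + fun p : Ω × (Fin d → ℝ) => ENNReal.ofReal (Y p.1 ⬝ᵥ p.2)) p ^ s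
        ∂P.prod ν := by
    refine (hprod (hX.add hY)).trans_le ?_
    refine lintegral_mono fun p => ENNReal.rpow_le_rpow ?_ hs.le
    simp only [Pi.add_apply, add_dotProduct]
    exact ENNReal.ofReal_add_le
  rw [hprod hX, hprod hY]
  rcases le_total 1 s with h | h
  · rw [max_eq_left h]
    exact (ENNReal.rpow_le_rpow hle (by positivity)).trans
      (ENNReal.lintegral_Lp_add_le (hF hX).aemeasurable (hF hY).aemeasurable h)
  · rw [max_eq_right h, one_div_one, ENNReal.rpow_one, ENNReal.rpow_one, ENNReal.rpow_one,
      ← lintegral_add_left ((hF hX).pow_const s)]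
    exact hle.trans (lintegral_mono fun p => ENNReal.rpow_add_le_add_rpow _ _ hs.le h)

variable {M : ℕ → Ω → Matrix (Fin d) (Fin d) ℝ} {Q : ℕ → Ω → Fin d → ℝ}

/-- A conditional expectation identity in integrated form. As `R(0) = 0`, restricting to a past
event `A` amounts to replacing `V*_n` by `A.indicator V*_n`, still independent of `M n`. -/
lemma lintegral_homEigenfun_mulVec_forward [IsProbabilityMeasure μ] (hd : 1 ≤ d) (hs : 0 < s)
    (hμ : ∀ᵐ g ∂μ, ∀ i j, 0 ≤ g i j) (hsI : s ∈ momentSet μ) (hν : IsConjEigenmeasure μ s k ν)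
    (hM : ∀ i, Measurable (M i)) (hQ : ∀ i, Measurable (Q i))
    (hindep : iIndepFun (fun n ω => (M n ω, Q n ω)) P) (hlaw : ∀ n, P.map (M n) = μ) {n : ℕ}
    {A : Set Ω} (hA : MeasurableSet[coordAlgebra M Q (Set.Iio n)] A) :
    ∫⁻ ω in A, homEigenfun s ν (M n ω *ᵥ forward M Q n ω) ∂P =
      ENNReal.ofReal k * ∫⁻ ω in A, homEigenfun s ν (forward M Q n ω) ∂P := by
  have hV := measurable_forward (M := M) (Q := Q) (n := n) (mΩ := coordAlgebra M Q (Set.Iio n))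
    (fun i hi => (measurable_coords M Q (Set.mem_Iio.2 hi)).1)
    (fun i hi => (measurable_coords M Q (Set.mem_Iio.2 hi)).2)
  have hle : coordAlgebra M Q (Set.Iio n) ≤ ‹MeasurableSpace Ω› :=
    iSup₂_le fun i _ => ((hM i).prodMk (hQ i)).comap_le
  have hX : Measurable[coordAlgebra M Q (Set.Iio n)] (A.indicator (forward M Q n)) :=
    hV.indicator hA
  have hind := (indepFun_of_measurable_coordAlgebra hM hQ hindep (k := n) (by simp) hX).comp
    measurable_fst measurable_id
  have key := lintegral_homEigenfun_mulVec_of_indepFun hd hs hμ hsI hν (hM n)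
    (hX.mono hle le_rfl) (hlaw n) hind
  rw [← lintegral_indicator (hle _ hA), ← lintegral_indicator (hle _ hA)]
  refine (lintegral_congr fun ω => ?_).trans
    (key.trans (congrArg _ (lintegral_congr fun ω => ?_)))
  · by_cases hω : ω ∈ A <;> simp [hω, homEigenfun_zero hs]
  · by_cases hω : ω ∈ A <;> simp [hω, homEigenfun_zero hs]

lemma exists_lintegral_homEigenfun_forward_le [IsProbabilityMeasure μ] (hd : 1 ≤ d) (hs : 0 < s)
    (hμ : ∀ᵐ g ∂μ, ∀ i j, 0 ≤ g i j) (hsI : s ∈ momentSet μ) (hν : IsConjEigenmeasure μ s k ν)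
    (hM : ∀ i, Measurable (M i)) (hQ : ∀ i, Measurable (Q i))
    (hindep : iIndepFun (fun n ω => (M n ω, Q n ω)) P) (hlaw : ∀ n, P.map (M n) = μ)
    {q : ℝ≥0∞} (hq : q ≠ ∞) (hQq : ∀ n, ∫⁻ ω, homEigenfun s ν (Q n ω) ∂P ≤ q) (hk : 1 < k) :
    ∃ B : ℝ≥0∞, B ≠ ∞ ∧
      ∀ n, ∫⁻ ω, homEigenfun s ν (forward M Q n ω) ∂P ≤ B * ENNReal.ofReal (k ^ n) := by
  have := hν.prob
  set p := max s 1 with hp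
  have hp0 : 0 < p := lt_max_of_lt_left hs
  set ρ : ℝ := k ^ (1 / p) with hρ
  have hρ1 : 1 < ρ := Real.one_lt_rpow hk (by positivity)
  have hρ0 : 0 < ρ - 1 := by linarith
  set S : ℕ → ℝ≥0∞ := fun n => (∫⁻ ω, homEigenfun s ν (forward M Q n ω) ∂P) ^ (1 / p) with hS
  have hrec : ∀ n, S (n + 1) ≤ ENNReal.ofReal ρ * S n + q ^ (1 / p) := by
    intro n
    have hfm : Measurable (forward M Q n) := measurable_forward (fun i _ => hM i) fun i _ => hQ i
    refine (lintegral_homEigenfun_add_rpow_le (P := P) (ν := ν) hs (measurable_mulVec (hM n) hfm)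
      (hQ n)).trans (add_le_add (le_of_eq ?_) (ENNReal.rpow_le_rpow (hQq n) (by positivity)))
    have := lintegral_homEigenfun_mulVec_forward hd hs hμ hsI hν hM hQ hindep hlaw (n := n)
      (A := Set.univ) MeasurableSet.univ
    rw [Measure.restrict_univ] at this
    rw [this, ENNReal.mul_rpow_of_nonneg _ _ (by positivity),
      ENNReal.ofReal_rpow_of_pos (by linarith)]
  -- The recursion from `S 0 = 0` sums to `1 + ρ + ⋯ + ρ ^ (n - 1)`, at most `ρ ^ n / (ρ - 1)`; here
  -- `k > 1` is essential. Raising to the power `p` turns `ρ ^ n` back into `k ^ n`.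
  have hbound : ∀ n, S n ≤ q ^ (1 / p) * ENNReal.ofReal ((ρ ^ n - 1) / (ρ - 1)) := by
    intro n
    induction n with
    | zero =>
      simp [hS, forward, homEigenfun_zero hs, hp0]
    | succ n ih =>
      have h1 : 0 ≤ (ρ ^ n - 1) / (ρ - 1) :=
        div_nonneg (sub_nonneg.2 (one_le_pow₀ hρ1.le)) hρ0.le
      have h2 : (ρ ^ (n + 1) - 1) / (ρ - 1) = ρ * ((ρ ^ n - 1) / (ρ - 1)) + 1 := by
        field_simp; ring
      rw [h2, ENNReal.ofReal_add (by positivity) zero_le_one, ENNReal.ofReal_mul (by positivity),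
        ENNReal.ofReal_one, mul_add, mul_one, mul_left_comm]
      exact (hrec n).trans (add_le_add (mul_le_mul' le_rfl ih) le_rfl)
  refine ⟨(q ^ (1 / p) * ENNReal.ofReal (1 / (ρ - 1))) ^ p, ?_, fun n => ?_⟩
  · exact ENNReal.rpow_ne_top_of_nonneg hp0.le (ENNReal.mul_ne_top
      (ENNReal.rpow_ne_top_of_nonneg (by positivity) hq) ENNReal.ofReal_ne_top)
  · have h1 : S n ≤ q ^ (1 / p) * ENNReal.ofReal (1 / (ρ - 1)) * ENNReal.ofReal (ρ ^ n) := by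
      refine (hbound n).trans ?_
      rw [mul_assoc, ← ENNReal.ofReal_mul (by positivity), one_div_mul_eq_div]
      refine mul_le_mul' le_rfl (ENNReal.ofReal_le_ofReal ?_)
      exact div_le_div_of_nonneg_right (by linarith) hρ0.le
    have h2 := ENNReal.rpow_le_rpow h1 hp0.le
    rw [hS, ← ENNReal.rpow_mul, one_div_mul_cancel hp0.ne', ENNReal.rpow_one,
      ENNReal.mul_rpow_of_nonneg _ _ hp0.le, ENNReal.ofReal_rpow_of_pos (by positivity)] at h2
    refine h2.trans_eq ?_
    congr 2
    rw [← Real.rpow_pow_comm (by positivity), hρ, ← Real.rpow_mul (by linarith),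
      one_div_mul_cancel hp0.ne', Real.rpow_one]

end

end

/-! ### The submartingale and the transfer between the two processes. -/

section

section

variable {Ω : Type*} [mΩ : MeasurableSpace Ω] {P : Measure Ω} [IsProbabilityMeasure P] {d : ℕ}
  {s k : ℝ} {μ : Measure (Matrix (Fin d) (Fin d) ℝ)} [IsProbabilityMeasure μ]
  {ν : Measure (Fin d → ℝ)}
  {M : ℕ → Ω → Matrix (Fin d) (Fin d) ℝ} {Q : ℕ → Ω → Fin d → ℝ}

omit [IsProbabilityMeasure μ] in
lemma weight_eq (hs : 0 < s) (hν : IsConjEigenmeasure μ s k ν) (n : ℕ) {v : Fin d → ℝ}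
    (hv : ∀ i, 0 ≤ v i) :
    weight s k ν n v = (1 / k ^ n) * (homEigenfun s ν v).toReal := by
  have := hν.prob
  rw [weight, vnorm_rpow_mul_eigenfun hs hν.ae_mem hv]

omit [IsProbabilityMeasure μ] in
lemma homEigenfun_ne_top (hs : 0 < s) (hν : IsConjEigenmeasure μ s k ν) (v : Fin d → ℝ) :
    homEigenfun s ν v ≠ ∞ := by
  have := hν.prob
  exact ((homEigenfun_le hs.le hν.ae_mem v).trans_lt
    (ENNReal.rpow_lt_top_of_nonneg hs.le ENNReal.ofReal_ne_top)).ne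

omit [IsProbabilityMeasure μ] in
lemma toReal_homEigenfun_le (hs : 0 < s) (hν : IsConjEigenmeasure μ s k ν) (v : Fin d → ℝ) :
    (homEigenfun s ν v).toReal ≤ vnorm v ^ s := by
  have := hν.prob
  refine ENNReal.toReal_le_of_le_ofReal (Real.rpow_nonneg (vnorm_nonneg v) s) ?_
  rw [← ENNReal.ofReal_rpow_of_nonneg (vnorm_nonneg v) hs.le]
  exact homEigenfun_le hs.le hν.ae_mem v

lemma exists_le_toReal_homEigenfun (hd : 1 ≤ d) (hs : 0 < s)
    (hμ : ∀ᵐ g ∂μ, ∀ i j, 0 ≤ g i j) (hsI : s ∈ momentSet μ)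
    (hpos : ∃ g ∈ Gam μ, ∀ i j, 0 < g i j) (hν : IsConjEigenmeasure μ s k ν) :
    ∃ c : ℝ, 0 < c ∧ ∀ v : Fin d → ℝ, (∀ i, 0 ≤ v i) →
      c * vnorm v ^ s ≤ (homEigenfun s ν v).toReal := by
  obtain ⟨c, hc, h⟩ := exists_le_homEigenfun hd hs hμ hsI hpos hν
  refine ⟨c, hc, fun v hv => ?_⟩
  have := h v hv
  rwa [ENNReal.ofReal_rpow_of_nonneg (vnorm_nonneg v) hs.le, ← ENNReal.ofReal_mul hc.le,
    ENNReal.ofReal_le_iff_le_toReal (homEigenfun_ne_top hs hν v)] at this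

omit [IsProbabilityMeasure P] [IsProbabilityMeasure μ] in
lemma integrable_weight_forward (hs : 0 < s) (hν : IsConjEigenmeasure μ s k ν)
    (hM0 : ∀ n ω i j, 0 ≤ M n ω i j) (hQ0 : ∀ n ω i, 0 ≤ Q n ω i)
    (hM : ∀ i, Measurable (M i)) (hQ : ∀ i, Measurable (Q i)) {n : ℕ}
    (hfin : ∫⁻ ω, homEigenfun s ν (forward M Q n ω) ∂P ≠ ∞) :
    Integrable (fun ω => weight s k ν n (forward M Q n ω)) P := by
  have := hν.prob
  simp_rw [fun ω => weight_eq hs hν n (forward_nonneg hM0 hQ0 n ω)]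
  exact (integrable_toReal_of_lintegral_ne_top ((measurable_homEigenfun s ν).comp
    (measurable_forward (fun i _ => hM i) fun i _ => hQ i)).aemeasurable hfin).const_mul _

theorem submartingale_weight_forward (hd : 1 ≤ d) (hs : 0 < s)
    (hμ : ∀ᵐ g ∂μ, ∀ i j, 0 ≤ g i j) (hsI : s ∈ momentSet μ) (hν : IsConjEigenmeasure μ s k ν)
    (hM0 : ∀ n ω i j, 0 ≤ M n ω i j) (hQ0 : ∀ n ω i, 0 ≤ Q n ω i)
    (hM : ∀ i, Measurable (M i)) (hQ : ∀ i, Measurable (Q i))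
    (hindep : iIndepFun (fun n ω => (M n ω, Q n ω)) P) (hlaw : ∀ n, P.map (M n) = μ) (hk : 0 < k)
    (hfin : ∀ n, ∫⁻ ω, homEigenfun s ν (forward M Q n ω) ∂P ≠ ∞) :
    Submartingale (fun n ω => weight s k ν n (forward M Q n ω)) (history M Q hM hQ) P := by
  have := hν.prob
  have hm := measurable_homEigenfun s ν
  have hfm : ∀ n, Measurable (forward M Q n) := fun n =>
    measurable_forward (fun i _ => hM i) fun i _ => hQ i
  have hhm : ∀ n, Measurable fun ω => homEigenfun s ν (forward M Q n ω) := fun n =>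
    hm.comp (hfm n)
  refine submartingale_of_setIntegral_le_succ (fun n => ?_)
    (fun n => integrable_weight_forward hs hν hM0 hQ0 hM hQ (hfin n)) fun n A hA => ?_
  · simp_rw [fun ω => weight_eq hs hν n (forward_nonneg hM0 hQ0 n ω)]
    have hV := measurable_forward (M := M) (Q := Q) (n := n) (mΩ := coordAlgebra M Q (Set.Iio n))
      (fun i hi => (measurable_coords M Q (Set.mem_Iio.2 hi)).1)
      (fun i hi => (measurable_coords M Q (Set.mem_Iio.2 hi)).2)
    exact ((hm.comp hV).ennreal_toReal.const_mul _).stronglyMeasurable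
  · have hset : ∀ j, ∫ ω in A, weight s k ν j (forward M Q j ω) ∂P =
        (1 / k ^ j) * (∫⁻ ω in A, homEigenfun s ν (forward M Q j ω) ∂P).toReal := fun j => by
      simp_rw [fun ω => weight_eq hs hν j (forward_nonneg hM0 hQ0 j ω)]
      rw [integral_const_mul, integral_toReal (hhm j).aemeasurable
        (ae_of_all _ fun ω => (homEigenfun_ne_top hs hν _).lt_top)]
    -- Dropping `Q n ≥ 0` from `V*_{n+1}` can only decrease `R`, and what is left is `R(M n V*_n)`.
    have hstep : ENNReal.ofReal k * ∫⁻ ω in A, homEigenfun s ν (forward M Q n ω) ∂P ≤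
        ∫⁻ ω in A, homEigenfun s ν (forward M Q (n + 1) ω) ∂P := by
      rw [← lintegral_homEigenfun_mulVec_forward hd hs hμ hsI hν hM hQ hindep hlaw hA]
      exact lintegral_mono fun ω => homEigenfun_mono hs.le hν.ae_mem fun i =>
        le_add_of_nonneg_right (hQ0 n ω i)
    have hreal := ENNReal.toReal_mono
      ((setLIntegral_le_lintegral A _).trans_lt (hfin (n + 1)).lt_top).ne hstep
    rw [ENNReal.toReal_mul, ENNReal.toReal_ofReal hk.le] at hreal
    rw [hset, hset, pow_succ]
    calc (1 / k ^ n) * (∫⁻ ω in A, homEigenfun s ν (forward M Q n ω) ∂P).toReal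
        = (1 / (k ^ n * k)) *
          (k * (∫⁻ ω in A, homEigenfun s ν (forward M Q n ω) ∂P).toReal) := by field_simp
      _ ≤ _ := mul_le_mul_of_nonneg_left hreal (by positivity)

lemma one_lt_kappa (hd : 1 ≤ d) (hM : ∀ i, Measurable (M i)) (hQ : ∀ i, Measurable (Q i))
    (hindep : iIndepFun (fun n ω => (M n ω, Q n ω)) P) (hlaw : ∀ n, P.map (M n) = μ) {t α : ℝ}
    (ht : 0 < t) (htα : t < α) (hαs : α < s) (hsI : s ∈ momentSet μ) (hα : kappa P M α = 1)
    (hκt : kappa P M t ≠ 1) : 1 < kappa P M s := by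
  have hα0 := ht.trans htα
  have hlim : ∀ r, 0 ≤ r → r ≤ s → Tendsto (fun n : ℕ => (moment μ r n).toReal ^ (1 / (n : ℝ)))
      atTop (𝓝 (kappa P M r)) := fun r hr hrs => by
    obtain ⟨l, -, hl, -⟩ := exists_growth_rate hd (momentSet_of_le hd hr hrs hsI)
    rwa [kappa_eq_of_tendsto hd hM hQ hindep hlaw hr hl]
  refine one_lt_growth_rate hd ht htα hαs hsI (hlim t ht.le (htα.trans hαs).le) ?_
    (hlim s (hα0.trans hαs).le le_rfl) hκt
  have h := hlim α hα0.le hαs.le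
  rwa [hα] at h

omit [IsProbabilityMeasure P] [IsProbabilityMeasure μ] in
lemma identDistrib_weight_perp_forward (hs : 0 < s) (hν : IsConjEigenmeasure μ s k ν)
    (hM0 : ∀ n ω i j, 0 ≤ M n ω i j) (hQ0 : ∀ n ω i, 0 ≤ Q n ω i) {n : ℕ}
    (hid : IdentDistrib (perp M Q n) (forward M Q n) P P) :
    IdentDistrib (fun ω => weight s k ν n (perp M Q n ω))
      (fun ω => weight s k ν n (forward M Q n ω)) P P := by
  have := hν.prob
  simp_rw [fun ω => weight_eq hs hν n (forward_nonneg hM0 hQ0 n ω),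
    fun ω => weight_eq hs hν n (perp_nonneg hM0 hQ0 n ω)]
  exact hid.comp ((measurable_homEigenfun s ν).ennreal_toReal.const_mul (1 / k ^ n))

end

end

end Perpetuity

/-! ### The theorem: monotone bounded means and comparison of `R` with `|·| ^ s`. -/

theorem lemma1p4 {Ω : Type*} [mΩ : MeasurableSpace Ω] (P : Measure Ω) [IsProbabilityMeasure P]
    {d : ℕ} (hd : 1 ≤ d)
    (M : ℕ → Ω → Matrix (Fin d) (Fin d) ℝ) (Q : ℕ → Ω → Fin d → ℝ)
    (hM : ∀ i, Measurable (M i)) (hQ : ∀ i, Measurable (Q i))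
    (hM0 : ∀ n ω i j, 0 ≤ M n ω i j) (hQ0 : ∀ n ω i, 0 ≤ Q n ω i)
    (hindep : iIndepFun (fun n ω => (M n ω, Q n ω)) P)
    (hident : ∀ n, IdentDistrib (fun ω => (M n ω, Q n ω)) (fun ω => (M 0 ω, Q 0 ω)) P P)
    (α : ℝ) (hα : MomentCondition P M Q α)
    (hnondeg : ∃ t : ℝ, 0 < t ∧ t < α ∧ kappa P M t ≠ 1)
    (hAP : AllowabilityPositivity (P.map (M 0)))
    (s : ℝ) (hs : α < s) (hsI : s ∈ momentSet (P.map (M 0)))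
    (hsQ : Integrable (fun ω => vnorm (Q 0 ω) ^ s) P) :
    (∃ ν : Measure (Fin d → ℝ), IsConjEigenmeasure (P.map (M 0)) s (kappa P M s) ν) ∧
    (∀ ν : Measure (Fin d → ℝ), IsConjEigenmeasure (P.map (M 0)) s (kappa P M s) ν →
      (∀ n, Integrable (fun ω => weight s (kappa P M s) ν n (perp M Q n ω)) P) ∧
      (∃ L : ℝ, 0 < L ∧
        Tendsto (fun n => ∫ ω, weight s (kappa P M s) ν n (perp M Q n ω) ∂P) atTop (𝓝 L) ∧
        Tendsto (fun n => ∫ ω, weight s (kappa P M s) ν n (forward M Q n ω) ∂P) atTop (𝓝 L)) ∧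
      Submartingale (fun n ω => weight s (kappa P M s) ν n (forward M Q n ω))
        (history M Q hM hQ) P ∧
      (∃ R : ℝ≥0, ∀ n,
        eLpNorm (fun ω => weight s (kappa P M s) ν n (forward M Q n ω)) 1 P ≤ R)) ∧
    (∀ n, Integrable (fun ω => vnorm (perp M Q n ω) ^ s) P ∧
      Integrable (fun ω => vnorm (forward M Q n ω) ^ s) P) ∧
    (∃ c C : ℝ, 0 < c ∧ ∀ n : ℕ, 1 ≤ n →
      (c ≤ (∫ ω, vnorm (perp M Q n ω) ^ s ∂P) / kappa P M s ^ n ∧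
        (∫ ω, vnorm (perp M Q n ω) ^ s ∂P) / kappa P M s ^ n ≤ C) ∧
      (c ≤ (∫ ω, vnorm (forward M Q n ω) ^ s ∂P) / kappa P M s ^ n ∧
        (∫ ω, vnorm (forward M Q n ω) ^ s ∂P) / kappa P M s ^ n ≤ C)) := by
  set μ := P.map (M 0) with hμdef
  have hμprob : IsProbabilityMeasure μ := Measure.isProbabilityMeasure_map (hM 0).aemeasurable
  have hlawΘ : ∀ n, P.map (fun ω => (M n ω, Q n ω)) = P.map (fun ω => (M 0 ω, Q 0 ω)) :=
    fun n => (hident n).map_eq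
  have hlaw : ∀ n, P.map (M n) = μ := fun n => ((hident n).comp measurable_fst).map_eq
  have hμ : ∀ᵐ g ∂μ, ∀ i j, 0 ≤ g i j := by
    rw [hμdef, ae_map_iff (hM 0).aemeasurable measurableSet_nonneg_entries]
    exact ae_of_all _ fun ω => hM0 0 ω
  obtain ⟨t, ht, htα, hκt⟩ := hnondeg
  have hs0 : 0 < s := (ht.trans htα).trans hs
  have hk := one_lt_kappa hd hM hQ hindep hlaw ht htα hs hsI hα.kappa_eq_one hκt
  have hex : ∃ ν : Measure (Fin d → ℝ), IsConjEigenmeasure μ s (kappa P M s) ν := by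
    obtain ⟨l, hl0, hl, hle⟩ := exists_growth_rate hd hsI
    have hkl := kappa_eq_of_tendsto hd hM hQ hindep hlaw hs0.le hl
    rw [hkl] at hk ⊢
    exact exists_isConjEigenmeasure hd hs0 hμ hsI (by linarith) hl hle
  set k := kappa P M s with hkdef
  have hk0 : 0 < k := by linarith
  have hfm : ∀ n, Measurable (forward M Q n) := fun n =>
    measurable_forward (fun i _ => hM i) fun i _ => hQ i
  have hpm : ∀ n, Measurable (perp M Q n) := fun n =>
    measurable_perp (fun i _ => hM i) fun i _ => hQ i
  have hid : ∀ n, IdentDistrib (perp M Q n) (forward M Q n) P P := fun n =>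
    ⟨(hpm n).aemeasurable, (hfm n).aemeasurable,
      (map_perp hM hQ hindep hlawΘ n).trans (map_forward hM hQ hindep hlawΘ n).symm⟩
  have hmain : ∀ ν : Measure (Fin d → ℝ), IsConjEigenmeasure μ s k ν →
      ∃ B : ℝ, (∀ n, Integrable (fun ω => weight s k ν n (forward M Q n ω)) P) ∧
        (∀ n, ∫ ω, weight s k ν n (forward M Q n ω) ∂P ≤ B) ∧
        0 < ∫ ω, weight s k ν 1 (forward M Q 1 ω) ∂P ∧
        Submartingale (fun n ω => weight s k ν n (forward M Q n ω)) (history M Q hM hQ) P := by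
    intro ν hν
    have hνp := hν.prob
    have hm := measurable_homEigenfun s ν
    have hhm : ∀ n, Measurable fun ω => homEigenfun s ν (forward M Q n ω) := fun n =>
      hm.comp (hfm n)
    have hQq : ∀ n, ∫⁻ ω, homEigenfun s ν (Q n ω) ∂P = ∫⁻ ω, homEigenfun s ν (Q 0 ω) ∂P :=
      fun n => (((hident n).comp measurable_snd).comp hm).lintegral_eq
    have hq : ∫⁻ ω, homEigenfun s ν (Q 0 ω) ∂P ≠ ∞ := by
      refine (lt_of_le_of_lt (lintegral_mono fun ω => ?_) hsQ.lintegral_lt_top).ne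
      rw [← ENNReal.ofReal_rpow_of_nonneg (vnorm_nonneg _) hs0.le]
      exact homEigenfun_le hs0.le hν.ae_mem _
    obtain ⟨B, hB, hBle⟩ := exists_lintegral_homEigenfun_forward_le hd hs0 hμ hsI hν hM hQ hindep
      hlaw hq (fun n => (hQq n).le) hk
    have hfin : ∀ n, ∫⁻ ω, homEigenfun s ν (forward M Q n ω) ∂P ≠ ∞ := fun n =>
      ((hBle n).trans_lt (ENNReal.mul_lt_top hB.lt_top ENNReal.ofReal_lt_top)).ne
    have hint : ∀ n, ∫ ω, weight s k ν n (forward M Q n ω) ∂P =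
        (1 / k ^ n) * (∫⁻ ω, homEigenfun s ν (forward M Q n ω) ∂P).toReal := fun n => by
      simp_rw [fun ω => weight_eq hs0 hν n (forward_nonneg hM0 hQ0 n ω)]
      rw [integral_const_mul, integral_toReal (hhm n).aemeasurable
        (ae_of_all _ fun ω => (homEigenfun_ne_top hs0 hν _).lt_top)]
    refine ⟨B.toReal, fun n => integrable_weight_forward hs0 hν hM0 hQ0 hM hQ (hfin n),
      fun n => ?_, ?_, submartingale_weight_forward hd hs0 hμ hsI hν hM0 hQ0 hM hQ hindep hlaw hk0
        hfin⟩
    · have := ENNReal.toReal_mono (ENNReal.mul_ne_top hB ENNReal.ofReal_ne_top) (hBle n)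
      rw [ENNReal.toReal_mul, ENNReal.toReal_ofReal (by positivity)] at this
      rw [hint, one_div, inv_mul_le_iff₀ (by positivity), mul_comm]
      exact this
    · rw [hint]
      refine mul_pos (by positivity) (ENNReal.toReal_pos ?_ (hfin 1))
      -- Here `V*_1 = Q 0`: if `E R(Q 0) = 0`, the lower bound on `R` forces `Q 0 = 0` almost
      -- surely.
      intro h0
      rw [lintegral_eq_zero_iff (hhm 1)] at h0
      obtain ⟨c, hc, hcle⟩ := exists_le_toReal_homEigenfun hd hs0 hμ hsI hAP.positive hν
      have hQ0ae : ∀ᵐ ω ∂P, Q 0 ω = 0 := by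
        filter_upwards [h0] with ω hω
        have hf : forward M Q 1 ω = Q 0 ω := by simp [forward]
        have h1 := hcle _ (hQ0 0 ω)
        rw [Pi.zero_apply, hf] at hω
        rw [hω, ENNReal.toReal_zero] at h1
        by_contra hne
        have := mul_pos hc (Real.rpow_pos_of_pos (vnorm_pos hne) s)
        linarith
      refine hα.nonzero.ne ?_
      rw [measure_congr (eventuallyEq_univ.2 hQ0ae), measure_univ]
  have hmono : ∀ ν : Measure (Fin d → ℝ),
      Submartingale (fun n ω => weight s k ν n (forward M Q n ω)) (history M Q hM hQ) P →
      -- The submartingale inequality on the whole space.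
      Monotone fun n => ∫ ω, weight s k ν n (forward M Q n ω) ∂P := fun ν hsub i j hij => by
    simpa using hsub.setIntegral_le hij MeasurableSet.univ
  have hwperp : ∀ ν : Measure (Fin d → ℝ), IsConjEigenmeasure μ s k ν → ∀ n,
      IdentDistrib (fun ω => weight s k ν n (perp M Q n ω))
        (fun ω => weight s k ν n (forward M Q n ω)) P P := fun ν hν n =>
    identDistrib_weight_perp_forward hs0 hν hM0 hQ0 (hid n)
  have hvperp : ∀ n, IdentDistrib (fun ω => vnorm (perp M Q n ω) ^ s)
      (fun ω => vnorm (forward M Q n ω) ^ s) P P := fun n =>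
    (hid n).comp (measurable_vnorm.pow_const s)
  obtain ⟨ν₀, hν₀⟩ := hex
  obtain ⟨c, hc, hcle⟩ := exists_le_toReal_homEigenfun hd hs0 hμ hsI hAP.positive hν₀
  obtain ⟨B₀, hint₀, hB₀, hpos₀, hsub₀⟩ := hmain ν₀ hν₀
  have hvle : ∀ n ω, vnorm (forward M Q n ω) ^ s ≤
      c⁻¹ * k ^ n * weight s k ν₀ n (forward M Q n ω) := fun n ω => by
    have hv := forward_nonneg hM0 hQ0 n ω
    rw [weight_eq hs0 hν₀ n hv, mul_assoc, ← mul_assoc (k ^ n), mul_one_div_cancel (by positivity),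
      one_mul, le_inv_mul_iff₀ hc]
    exact hcle _ hv
  have hvint : ∀ n, Integrable (fun ω => vnorm (forward M Q n ω) ^ s) P := fun n => by
    refine Integrable.mono' ((hint₀ n).const_mul (c⁻¹ * k ^ n))
      ((measurable_vnorm.comp (hfm n)).pow_const s).aestronglyMeasurable (ae_of_all _ fun ω => ?_)
    rw [Real.norm_of_nonneg (Real.rpow_nonneg (vnorm_nonneg _) s)]
    exact hvle n ω
  -- A single eigenmeasure `ν₀` suffices for the moment bounds. The lower constant is the mean at `n
  -- = 1`, the first index where it is positive since `V*_0 = 0`; the upper one is the bound on the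
  -- means divided by the constant in `R(v) ≥ c |v| ^ s`.
  refine ⟨⟨ν₀, hν₀⟩, fun ν hν => ?_, fun n => ⟨(hvperp n).integrable_iff.2 (hvint n), hvint n⟩,
    ∫ ω, weight s k ν₀ 1 (forward M Q 1 ω) ∂P, c⁻¹ * B₀, hpos₀, fun n hn => ?_⟩
  · obtain ⟨B, hint, hB, hpos, hsub⟩ := hmain ν hν
    have hbdd : BddAbove (Set.range fun n => ∫ ω, weight s k ν n (forward M Q n ω) ∂P) :=
      ⟨B, Set.forall_mem_range.2 hB⟩
    -- Increasing bounded means converge to their supremum, which is positive because the mean at `n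
    -- = 1` is.
    have hlim := tendsto_atTop_ciSup (hmono ν hsub) hbdd
    refine ⟨fun n => (hwperp ν hν n).integrable_iff.2 (hint n),
      ⟨_, hpos.trans_le (le_ciSup hbdd 1), ?_, hlim⟩, hsub, B.toNNReal, fun n => ?_⟩
    · exact hlim.congr fun n => (hwperp ν hν n).integral_eq.symm
    · have hnorm : ∀ ω, ‖weight s k ν n (forward M Q n ω)‖ = weight s k ν n (forward M Q n ω) :=
        fun ω => Real.norm_of_nonneg (by
          rw [weight_eq hs0 hν n (forward_nonneg hM0 hQ0 n ω)]; positivity)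
      rw [eLpNorm_one_eq_lintegral_enorm, ← ofReal_integral_norm_eq_lintegral_enorm (hint n)]
      simp_rw [hnorm]
      exact ENNReal.ofReal_le_ofReal (hB n)
  · have hforward : ∫ ω, weight s k ν₀ 1 (forward M Q 1 ω) ∂P ≤
        (∫ ω, vnorm (forward M Q n ω) ^ s ∂P) / k ^ n ∧
        (∫ ω, vnorm (forward M Q n ω) ^ s ∂P) / k ^ n ≤ c⁻¹ * B₀ := by
      refine ⟨(hmono ν₀ hsub₀ hn).trans ?_, ?_⟩
      · rw [div_eq_inv_mul, ← integral_const_mul]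
        refine integral_mono (hint₀ n) ((hvint n).const_mul _) fun ω => ?_
        simp only
        rw [weight_eq hs0 hν₀ n (forward_nonneg hM0 hQ0 n ω), one_div]
        exact mul_le_mul_of_nonneg_left (toReal_homEigenfun_le hs0 hν₀ _) (by positivity)
      · rw [div_le_iff₀ (by positivity)]
        have h1 := integral_mono (hvint n) ((hint₀ n).const_mul (c⁻¹ * k ^ n)) (hvle n)
        rw [integral_const_mul] at h1
        have h2 := mul_le_mul_of_nonneg_left (hB₀ n) (show 0 ≤ c⁻¹ * k ^ n by positivity)
        linarith
    refine ⟨?_, hforward⟩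
    rwa [(hvperp n).integral_eq]
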